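/- All graphs are finite and simple, and a graph contains $H$ if it has an induced subgraph isomorphic to $H$. A path or cycle in a graph is chordless if no edge of the graph joins two of its nodes without being one of its own edges; a hole is a chordless cycle of length at least $4$. - A theta is a graph made of three internally node-disjoint chordless paths $P_1,P_2,P_3$, each of length at least $2$ and with the same two ends $a$ and $b$, such that no edges exist between the paths except the three edges incident to $a$ and the three edges incident to $b$. - A pyramid is a graph made of three chordless paths $P_i=a\dots b_i$ ($i=1,2,3$) of length at least $1$, two of which have length at least $2$, node-disjoint except at $a$, such that $b_1b_2b_3$ is a triangle and no edges exist between the paths except those of the triangle and the three edges incident to $a$. - A wheel is a graph formed by a hole $H$ together with a node $c$ outside $H$ that has at least three neighbors in $H$. A graph is only-prism if it contains no theta, no wheel and no pyramid. A graph is chordless if all its cycles are chordless. A clique cutset of a graph $G$ is a (possibly empty) set $S$ of pairwise adjacent nodes such that $G\setminus S$ is disconnected. **Theorem.** If $G$ is an only-prism graph, then $G$ is (isomorphic to) the line graph of a triangle-free chordless graph, or $G$ has a clique cutset. -/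

import Mathlib

namespace SimpleGraph

variable {V : Type*} (G : SimpleGraph V)

/-- A hole of `G`: a closed walk that is a chordless cycle of length at least 4. -/
def Walk.IsHole {G : SimpleGraph V} {v : V} (C : G.Walk v v) : Prop :=
  C.IsCycle ∧ C.IsChordless ∧ 4 ≤ C.length

/-- The three walks `P 0`, `P 1`, `P 2` of `G` from `a` to `b` form a theta that is an
induced subgraph of `G`. -/
structure IsInducedTheta {a b : V} (P : Fin 3 → G.Walk a b) : Prop where
  isPath : ∀ i, (P i).IsPath
  isChordless : ∀ i, (P i).IsChordless
  two_le_length : ∀ i, 2 ≤ (P i).length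
  /-- The paths are internally node-disjoint. -/
  disjoint : ∀ i j, i ≠ j → ∀ u, u ∈ (P i).support → u ∈ (P j).support → u = a ∨ u = b
  /-- The only edges between two of the paths are those incident to `a` or `b`. (As the paths are
  chordless, such an edge is then an edge of one of the paths.) -/
  edges_between : ∀ i j, i ≠ j → ∀ u v, u ∈ (P i).support → v ∈ (P j).support → G.Adj u v →
    (u = a ∨ u = b) ∨ (v = a ∨ v = b)

/-- The walks `P i` (`i = 0, 1, 2`) of `G` from `a` to `b i` form a pyramid that is an induced
subgraph of `G`, with apex `a` and triangle `b 0`, `b 1`, `b 2`. -/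
structure IsInducedPyramid {a : V} {b : Fin 3 → V} (P : (i : Fin 3) → G.Walk a (b i)) :
    Prop where
  isPath : ∀ i, (P i).IsPath
  isChordless : ∀ i, (P i).IsChordless
  one_le_length : ∀ i, 1 ≤ (P i).length
  /-- Two of the paths have length at least 2. -/
  two_le_length : ∃ i j, i ≠ j ∧ 2 ≤ (P i).length ∧ 2 ≤ (P j).length
  /-- The paths are node-disjoint except at `a`. -/
  disjoint : ∀ i j, i ≠ j → ∀ u, u ∈ (P i).support → u ∈ (P j).support → u = a
  triangle : ∀ i j, i ≠ j → G.Adj (b i) (b j)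
  /-- The only edges between two of the paths are those of the triangle and those incident to `a`.
  (As the paths are chordless, an edge incident to `a` is then an edge of one of the paths.) -/
  edges_between : ∀ i j, i ≠ j → ∀ u v, u ∈ (P i).support → v ∈ (P j).support → G.Adj u v →
    (u = b i ∧ v = b j) ∨ u = a ∨ v = a

/-- The closed walk `H` of `G` (the rim) and the node `c` (the center) form a wheel: `H` is a hole
and `c` is a node outside `H` with at least three neighbors in `H`. -/
def IsInducedWheel {v : V} (H : G.Walk v v) (c : V) : Prop :=
  H.IsHole ∧ c ∉ H.support ∧ 3 ≤ {u | u ∈ H.support ∧ G.Adj c u}.ncard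

/-- `G` does not contain a theta as an induced subgraph. -/
def ThetaFree : Prop :=
  ∀ (a b : V) (P : Fin 3 → G.Walk a b), ¬ G.IsInducedTheta P

/-- `G` does not contain a pyramid as an induced subgraph. -/
def PyramidFree : Prop :=
  ∀ (a : V) (b : Fin 3 → V) (P : (i : Fin 3) → G.Walk a (b i)), ¬ G.IsInducedPyramid P

/-- `G` does not contain a wheel as an induced subgraph. -/
def WheelFree : Prop :=
  ∀ (v : V) (H : G.Walk v v) (c : V), ¬ G.IsInducedWheel H c

/-- Only-prism graphs: (theta, wheel, pyramid)-free graphs. -/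
def IsOnlyPrism : Prop :=
  G.ThetaFree ∧ G.WheelFree ∧ G.PyramidFree

/-- A graph is chordless if all its cycles are chordless. -/
def IsChordlessGraph : Prop :=
  ∀ (v : V) (C : G.Walk v v), C.IsCycle → C.IsChordless

/-- `S` is a clique cutset of `G`: a clique, possibly empty, whose deletion disconnects `G`, that
is, leaves two nodes that no walk avoiding `S` joins. -/
def IsCliqueCutset (S : Set V) : Prop :=
  G.IsClique S ∧ ¬ (G.induce Sᶜ).Preconnected

end SimpleGraph

namespace SimpleGraph

variable {V : Type*} {G : SimpleGraph V}

/-! Suppose that there is no clique cutset. The core of the proof is that the graph then contains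
neither a diamond nor a claw. Such a graph is the line graph of a triangle-free graph: each
neighborhood is a disjoint union of at most two cliques, and these become the two ends of an edge of
the root. A chord of a cycle of the root would be the center of a wheel in the line graph, so the
root is chordless.

Diamonds (`WheelFree.adj_of_common_neighbors`): take a maximal clique among those that contain a
given edge and are complete to two nonadjacent nodes. It does not separate these two nodes, and
wheel-freeness makes it complete to the second node of an induced path joining them outside it.
Either this node extends the clique, or the path can be shortened.

Claws (`IsOnlyPrism.false_of_claw`): without diamonds the neighbors of the center `a` fall into
cliques with no edges between them, and a claw gives at least three of these. By
`IsOnlyPrism.false_of_three_attachments` each component of the non-neighbors of `a` attaches to at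
most two of them. Since `a` alone is not a cutset, some component attaches to exactly two; since `a`
with either of these two cliques is not a cutset, the two are also joined by a path that avoids such
components and meets a third clique. The two connections form the rim of a wheel with center `a`.

Paths are functions on `ℕ`, whose values beyond the length are irrelevant; they become walks only
when a theta, a wheel or a pyramid is produced. -/

/-- The nodes `f 0, …, f n` form, in this order, a path of length `n` that is an induced subgraph
of `G`. -/
structure IsInducedPath (G : SimpleGraph V) (f : ℕ → V) (n : ℕ) : Prop where
  inj : ∀ i j, i ≤ n → j ≤ n → f i = f j → i = j
  adj : ∀ i, i < n → G.Adj (f i) (f (i + 1))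
  succ_of_adj : ∀ i j, i ≤ n → j ≤ n → G.Adj (f i) (f j) → i + 1 = j ∨ j + 1 = i

/-! ### Reversing, slicing and gluing induced paths -/

namespace IsInducedPath

variable {f g : ℕ → V} {n m : ℕ}

theorem reverse (hf : G.IsInducedPath f n) : G.IsInducedPath (fun k => f (n - k)) n where
  inj i j hi hj h := by
    have := hf.inj _ _ (by omega) (by omega) h
    omega
  adj i hi := by
    have := (hf.adj (n - (i + 1)) (by omega)).symm
    rwa [show n - (i + 1) + 1 = n - i by omega] at this
  succ_of_adj i j hi hj h := by
    have := hf.succ_of_adj _ _ (by omega) (by omega) h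
    omega

theorem slice (hf : G.IsInducedPath f n) (i l : ℕ) (h : i + l ≤ n) :
    G.IsInducedPath (fun k => f (i + k)) l where
  inj j k hj hk h := by
    have := hf.inj _ _ (by omega) (by omega) h
    omega
  adj j hj := hf.adj (i + j) (by omega)
  succ_of_adj j k hj hk h := by
    have := hf.succ_of_adj _ _ (by omega) (by omega) h
    omega

theorem append (hf : G.IsInducedPath f n) (hg : G.IsInducedPath g m) (h : f n = g 0)
    (hne : ∀ i j, i < n → 0 < j → j ≤ m → f i ≠ g j)
    (hadj : ∀ i j, i < n → 0 < j → j ≤ m → ¬ G.Adj (f i) (g j)) :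
    G.IsInducedPath (fun k => if k ≤ n then f k else g (k - n)) (n + m) := by
  have key : ∀ i j, i ≤ n → n < j → j ≤ n + m → f i = g (j - n) → False := by
    intro i j hi hj hj' he
    rcases hi.lt_or_eq with hi | rfl
    · exact hne _ _ hi (by omega) (by omega) he
    · have := hg.inj _ _ (by omega) (by omega) (h.symm.trans he)
      omega
  have key' : ∀ i j, i ≤ n → n < j → j ≤ n + m → G.Adj (f i) (g (j - n)) → i + 1 = j := by
    intro i j hi hj hj' he
    rcases hi.lt_or_eq with hi | rfl
    · exact (hadj _ _ hi (by omega) (by omega) he).elim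
    · rw [h] at he
      have := hg.succ_of_adj _ _ (by omega) (by omega) he
      omega
  refine ⟨fun i j hi hj he => ?_, fun i hi => ?_, fun i j hi hj he => ?_⟩
  · split_ifs at he with h1 h2 h2
    · exact hf.inj _ _ h1 h2 he
    · exact (key i j h1 (by omega) hj he).elim
    · exact (key j i h2 (by omega) hi he.symm).elim
    · have := hg.inj _ _ (by omega) (by omega) he
      omega
  · split_ifs with h1 h2 h2
    · exact hf.adj _ (by omega)
    · obtain rfl : i = n := by omega
      rw [h, show i + 1 - i = 0 + 1 by omega]
      exact hg.adj _ (by omega)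
    · omega
    · rw [show i + 1 - n = i - n + 1 by omega]
      exact hg.adj _ (by omega)
  · split_ifs at he with h1 h2 h2
    · exact hf.succ_of_adj _ _ h1 h2 he
    · exact .inl (key' i j h1 (by omega) hj he)
    · exact .inr (key' j i h2 (by omega) hi he.symm)
    · have := hg.succ_of_adj _ _ (by omega) (by omega) he
      omega

theorem edge {a b : V} (h : G.Adj a b) : G.IsInducedPath (fun k => if k = 0 then a else b) 1 := by
  refine ⟨fun i j hi hj he => ?_, fun i hi => ?_, fun i j hi hj he => ?_⟩
  · split_ifs at he with h1 h2 h2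
    · omega
    · exact (h.ne he).elim
    · exact (h.ne he.symm).elim
    · omega
  · obtain rfl : i = 0 := by omega
    simpa using h
  · split_ifs at he with h1 h2 h2
    · exact (he.ne rfl).elim
    · omega
    · omega
    · exact (he.ne rfl).elim

theorem cons {a : V} (hf : G.IsInducedPath f n) (ha : G.Adj a (f 0))
    (hne : ∀ i, 0 < i → i ≤ n → a ≠ f i) (hadj : ∀ i, 0 < i → i ≤ n → ¬ G.Adj a (f i)) :
    G.IsInducedPath (fun k => if k = 0 then a else f (k - 1)) (n + 1) := by
  have := (edge ha).append hf rfl (fun i j hi hj hj' => by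
    obtain rfl : i = 0 := by omega
    exact hne j hj hj') (fun i j hi hj hj' => by
    obtain rfl : i = 0 := by omega
    exact hadj j hj hj')
  rw [add_comm]
  convert this using 2 with k
  by_cases h0 : k = 0
  · simp [h0]
  · by_cases h1 : k = 1
    · simp [h1]
    · simp [h0, show ¬ k ≤ 1 by omega]

theorem snoc {b : V} (hf : G.IsInducedPath f n) (hb : G.Adj (f n) b)
    (hne : ∀ i, i < n → f i ≠ b) (hadj : ∀ i, i < n → ¬ G.Adj (f i) b) :
    G.IsInducedPath (fun k => if k ≤ n then f k else b) (n + 1) := by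
  have := hf.append (edge hb) rfl (fun i j hi hj hj' => by simpa [hj.ne'] using hne i hi)
    (fun i j hi hj hj' => by simpa [hj.ne'] using hadj i hi)
  convert this using 2 with k
  by_cases h0 : k ≤ n
  · simp [h0]
  · simp [h0, show k - n ≠ 0 by omega]

end IsInducedPath

/-! ### From indexed paths to walks, holes, thetas and pyramids -/

theorem exists_walk_of_adj_succ (f : ℕ → V) (n : ℕ) (h : ∀ i, i < n → G.Adj (f i) (f (i + 1))) :
    ∃ p : G.Walk (f 0) (f n), p.length = n ∧ ∀ i, i ≤ n → p.getVert i = f i := by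
  induction n generalizing f with
  | zero => exact ⟨.nil, rfl, fun i hi => by simp [Nat.le_zero.mp hi]⟩
  | succ n ih =>
    obtain ⟨p, hp, hp'⟩ := ih (fun k => f (k + 1)) fun i hi => h (i + 1) (by omega)
    refine ⟨.cons (h 0 (by omega)) p, by simp [hp], fun i hi => ?_⟩
    cases i with
    | zero => simp
    | succ i => simpa using hp' i (by omega)

theorem IsInducedPath.exists_walk {f : ℕ → V} {n : ℕ} (hf : G.IsInducedPath f n) {a b : V}
    (ha : f 0 = a) (hb : f n = b) :
    ∃ p : G.Walk a b, p.IsPath ∧ p.IsChordless ∧ p.length = n ∧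
      ∀ u, u ∈ p.support ↔ ∃ i, i ≤ n ∧ f i = u := by
  subst ha hb
  obtain ⟨p, hp, hp'⟩ := exists_walk_of_adj_succ f n hf.adj
  have hs : ∀ u, u ∈ p.support ↔ ∃ i, i ≤ n ∧ f i = u := by
    intro u
    rw [Walk.mem_support_iff_exists_getVert, hp]
    constructor
    · rintro ⟨i, rfl, hi⟩
      exact ⟨i, hi, (hp' i hi).symm⟩
    · rintro ⟨i, hi, rfl⟩
      exact ⟨i, hp' i hi, hi⟩
  refine ⟨p, ?_, ?_, hp, hs⟩
  · rw [← Walk.IsPath.getVert_injOn_iff]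
    intro i hi j hj hij
    simp only [Set.mem_ofPred_eq, hp] at hi hj
    rw [hp' i hi, hp' j hj] at hij
    exact hf.inj _ _ hi hj hij
  · rw [Walk.isChordless_iff_forall_mem_edges]
    have key : ∀ i, i < n → s(f i, f (i + 1)) ∈ p.edges := by
      intro i hi
      rw [Walk.mk_mem_edges_iff_exists]
      exact ⟨i, by omega, by rw [hp' i hi.le, hp' (i + 1) hi]⟩
    intro u v hu hv huv
    obtain ⟨i, hi, rfl⟩ := (hs u).1 hu
    obtain ⟨j, hj, rfl⟩ := (hs v).1 hv
    rcases hf.succ_of_adj i j hi hj huv with rfl | rfl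
    · exact key i (by omega)
    · rw [Sym2.eq_swap]
      exact key j (by omega)

/-- Closing the path through `c` gives a cycle of length `k + 2`, whence the bound on `k`. -/
theorem IsInducedPath.exists_isHole {h : ℕ → V} {k : ℕ} (hh : G.IsInducedPath h k) (hk : 2 ≤ k)
    {c : V} (hc : ∀ i, i ≤ k → c ≠ h i) (h0 : G.Adj c (h 0)) (h1 : G.Adj c (h k))
    (hadj : ∀ i, 0 < i → i < k → ¬ G.Adj c (h i)) :
    ∃ C : G.Walk c c, C.IsHole ∧ ∀ u, u ∈ C.support ↔ u = c ∨ ∃ i, i ≤ k ∧ h i = u := by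
  obtain ⟨p, hp, hpc, hpl, hps⟩ := hh.exists_walk rfl rfl
  have hcp : c ∉ p.support := by
    rw [hps]
    rintro ⟨i, hi, he⟩
    exact hc i hi he.symm
  have hsup : ∀ u, u ∈ (Walk.cons h0 (p.concat h1.symm)).support ↔
      u = c ∨ ∃ i, i ≤ k ∧ h i = u := by
    intro u
    rw [← hps u]
    simp only [Walk.support_cons, Walk.support_concat, List.mem_cons, List.mem_append]
    simp
    tauto
  refine ⟨.cons h0 (p.concat h1.symm), ⟨?_, ?_, ?_⟩, hsup⟩
  · rw [Walk.cons_isCycle_iff]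
    refine ⟨hp.concat hcp _, ?_⟩
    rw [Walk.edges_concat, List.concat_eq_append, List.mem_append, List.mem_singleton, not_or]
    refine ⟨fun h => hcp (p.fst_mem_support_of_mem_edges h), fun h => ?_⟩
    rw [Sym2.eq_swap, Sym2.congr_left] at h
    have := hh.inj _ _ (by omega) (by omega) h
    omega
  · rw [Walk.isChordless_iff_forall_mem_edges]
    have key : ∀ i, i ≤ k → G.Adj c (h i) →
        s(c, h i) ∈ (Walk.cons h0 (p.concat h1.symm)).edges := by
      intro i hi ha
      rcases Nat.eq_zero_or_pos i with rfl | hi0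
      · simp
      rcases hi.lt_or_eq with hik | rfl
      · exact (hadj i hi0 hik ha).elim
      · rw [Sym2.eq_swap]
        simp [Walk.edges_concat]
    intro u v hu hv huv
    rcases (hsup u).1 hu with rfl | ⟨i, hi, rfl⟩
    · rcases (hsup v).1 hv with rfl | ⟨j, hj, rfl⟩
      · exact (huv.ne rfl).elim
      · exact key j hj huv
    · rcases (hsup v).1 hv with rfl | ⟨j, hj, rfl⟩
      · rw [Sym2.eq_swap]
        exact key i hi huv.symm
      · have := hpc.mem_edges ((hps _).2 ⟨i, hi, rfl⟩) ((hps _).2 ⟨j, hj, rfl⟩) huv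
        simp [Walk.edges_concat, this]
  · simp [hpl]
    omega

/-- In a wheel-free graph, a node has at most two neighbors in a hole. The hole is given as the
union of two induced paths with the same ends. -/
theorem WheelFree.false_of_three_adj (hG : G.WheelFree) {f r : ℕ → V} {n m : ℕ}
    (hf : G.IsInducedPath f n) (hr : G.IsInducedPath r m) (h0 : f 0 = r 0) (h1 : f n = r m)
    (hn : 2 ≤ n) (hm : 2 ≤ m)
    (hne : ∀ i j, 0 < i → i < n → 0 < j → j < m → f i ≠ r j)
    (hadj : ∀ i j, 0 < i → i < n → 0 < j → j < m → ¬ G.Adj (f i) (r j))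
    {c : V} (hcf : ∀ i, i ≤ n → c ≠ f i) (hcr : ∀ i, i ≤ m → c ≠ r i)
    {S : Set V} (hS : ∀ u ∈ S, (∃ i, i ≤ n ∧ f i = u) ∨ ∃ i, i ≤ m ∧ r i = u)
    {u v w : V} (huv : u ≠ v) (huw : u ≠ w) (hvw : v ≠ w) (hu : u ∈ S) (hv : v ∈ S) (hw : w ∈ S)
    (hcu : G.Adj c u) (hcv : G.Adj c v) (hcw : G.Adj c w) : False := by
  -- The hole is opened at `f 0`: what remains runs along `r` from `r 1` to `r m = f n`, then back
  -- along `f` to `f 1`.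
  have hpath := (hr.slice 1 (m - 1) (by omega)).append ((hf.slice 1 (n - 1) (by omega)).reverse)
    (by rw [show 1 + (m - 1) = m by omega, show 1 + (n - 1 - 0) = n by omega, h1])
    (fun i j hi hj hj' => (hne _ _ (by omega) (by omega) (by omega) (by omega)).symm)
    (fun i j hi hj hj' ha => hadj _ _ (by omega) (by omega) (by omega) (by omega) ha.symm)
  obtain ⟨C, hC, hsup⟩ := hpath.exists_isHole (by omega) (c := f 0) (fun i hi => by
      split_ifs with h
      · rw [h0]
        intro he
        have := hr.inj _ _ (by omega) (by omega) he
        omega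
      · intro he
        have := hf.inj _ _ (by omega) (by omega) he
        omega)
    (by
      rw [if_pos (by omega), h0]
      exact hr.adj 0 (by omega))
    (by
      split_ifs with h
      · omega
      · rw [show 1 + (n - 1 - (m - 1 + (n - 1) - (m - 1))) = 0 + 1 by omega]
        exact hf.adj 0 (by omega))
    (fun i hi hi' => by
      split_ifs with h
      · rw [h0]
        intro he
        have := hr.succ_of_adj _ _ (by omega) (by omega) he
        omega
      · intro he
        have := hf.succ_of_adj _ _ (by omega) (by omega) he
        omega)
  have hmem : ∀ x, x ∈ C.support ↔ (∃ i, i ≤ n ∧ f i = x) ∨ ∃ i, i ≤ m ∧ r i = x := by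
    intro x
    rw [hsup]
    constructor
    · rintro (rfl | ⟨i, hi, rfl⟩)
      · exact .inl ⟨0, by omega, rfl⟩
      · split_ifs with h
        · exact .inr ⟨_, by omega, rfl⟩
        · exact .inl ⟨_, by omega, rfl⟩
    · rintro (⟨i, hi, rfl⟩ | ⟨i, hi, rfl⟩)
      · rcases Nat.eq_zero_or_pos i with rfl | hi0
        · exact .inl rfl
        · right
          rcases hi.lt_or_eq with hin | rfl
          · refine ⟨m - 1 + (n - i), by omega, ?_⟩
            rw [if_neg (by omega)]
            congr 1
            omega
          · refine ⟨m - 1, by omega, ?_⟩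
            rw [if_pos (by omega), h1]
            congr 1
            omega
      · rcases Nat.eq_zero_or_pos i with rfl | hi0
        · exact .inl h0.symm
        · refine .inr ⟨i - 1, by omega, ?_⟩
          rw [if_pos (by omega)]
          congr 1
          omega
  refine hG _ C c ⟨hC, ?_, ?_⟩
  · rw [hmem]
    rintro (⟨i, hi, he⟩ | ⟨i, hi, he⟩)
    · exact hcf i hi he.symm
    · exact hcr i hi he.symm
  · have hsub : ({u, v, w} : Set V) ⊆ {u | u ∈ C.support ∧ G.Adj c u} := by
      rintro x (rfl | rfl | rfl)
      · exact ⟨(hmem _).2 (hS _ hu), hcu⟩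
      · exact ⟨(hmem _).2 (hS _ hv), hcv⟩
      · exact ⟨(hmem _).2 (hS _ hw), hcw⟩
    have hfin : {u | u ∈ C.support ∧ G.Adj c u}.Finite :=
      (List.finite_toSet C.support).subset fun x hx => hx.1
    have h3 := Set.ncard_eq_three.2 ⟨u, v, w, huv, huw, hvw, rfl⟩
    exact h3 ▸ Set.ncard_le_ncard hsub hfin

/-- The special case of a hole made of an induced path and a node adjacent to its ends only. -/
theorem WheelFree.false_of_adj_path (hG : G.WheelFree) {f : ℕ → V} {n : ℕ}
    (hf : G.IsInducedPath f n) (hn : 2 ≤ n) {a : V} (ha : ∀ i, i ≤ n → a ≠ f i)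
    (haf : ∀ i, i ≤ n → (G.Adj a (f i) ↔ i = 0 ∨ i = n))
    {c : V} (hca : G.Adj c a) (hc : ∀ i, i ≤ n → c ≠ f i) {i j : ℕ} (hij : i ≠ j) (hi : i ≤ n)
    (hj : j ≤ n) (hci : G.Adj c (f i)) (hcj : G.Adj c (f j)) : False := by
  -- The second path of the hole is `f 0, a, f n`.
  have hr := (IsInducedPath.edge ((haf 0 (by omega)).2 (.inl rfl)).symm).snoc
    (b := f n) (by simpa using (haf n le_rfl).2 (.inr rfl)) (fun i hi => by
      obtain rfl : i = 0 := by omega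
      intro he
      have := hf.inj _ _ (by omega) (by omega) he
      omega) (fun i hi => by
      obtain rfl : i = 0 := by omega
      intro he
      have := hf.succ_of_adj _ _ (by omega) (by omega) he
      omega)
  refine hG.false_of_three_adj hf hr rfl rfl hn le_rfl (c := c)
    (S := {x | x = a ∨ ∃ i, i ≤ n ∧ f i = x}) ?_ ?_ hc ?_ ?_
    (u := a) (v := f i) (w := f j) (ha i hi) (ha j hj) (fun h => hij (hf.inj _ _ hi hj h))
    (.inl rfl) (.inr ⟨i, hi, rfl⟩) (.inr ⟨j, hj, rfl⟩) hca hci hcj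
  · intro i j hi hi' hj hj'
    obtain rfl : j = 1 := by omega
    simpa using (ha i hi'.le).symm
  · intro i j hi hi' hj hj'
    obtain rfl : j = 1 := by omega
    have := haf i hi'.le
    simp only [le_refl, if_true, one_ne_zero, if_false, G.adj_comm (f i), this]
    omega
  · intro i hi
    split_ifs with h1 h2
    · exact hc 0 (by omega)
    · exact hca.ne
    · exact hc n le_rfl
  · rintro x (rfl | h)
    · exact .inr ⟨1, by omega, by simp⟩
    · exact .inl h

/-- By symmetry only pairs `i < j` need checking, and only inner nodes, as the definition puts no
condition on pairs involving `a` or `b`. -/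
theorem ThetaFree.false_of_paths (hG : G.ThetaFree) {a b : V} (f : Fin 3 → ℕ → V) (n : Fin 3 → ℕ)
    (hf : ∀ i, G.IsInducedPath (f i) (n i)) (h0 : ∀ i, f i 0 = a) (h1 : ∀ i, f i (n i) = b)
    (hn : ∀ i, 2 ≤ n i)
    (hne : ∀ i j, i < j → ∀ k l, 0 < k → k < n i → 0 < l → l < n j → f i k ≠ f j l)
    (hadj : ∀ i j, i < j → ∀ k l, 0 < k → k < n i → 0 < l → l < n j → ¬ G.Adj (f i k) (f j l)) :
    False := by
  choose P hP hPc hPl hPs using fun i => (hf i).exists_walk (h0 i) (h1 i)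
  have key : ∀ i k, k ≤ n i → (0 < k ∧ k < n i) ∨ (f i k = a ∨ f i k = b) := by
    intro i k hk
    rcases Nat.eq_zero_or_pos k with rfl | hk0
    · exact .inr (.inl (h0 i))
    · rcases hk.lt_or_eq with hk | rfl
      · exact .inl ⟨hk0, hk⟩
      · exact .inr (.inr (h1 i))
  refine hG a b P ⟨hP, hPc, fun i => by rw [hPl]; exact hn i, ?_, ?_⟩
  · intro i j hij u hu hu'
    obtain ⟨k, hk, rfl⟩ := (hPs _ _).1 hu
    obtain ⟨l, hl, he⟩ := (hPs _ _).1 hu'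
    rcases key i k hk with ⟨hk0, hk1⟩ | h
    · rcases key j l hl with ⟨hl0, hl1⟩ | h
      · rcases lt_or_gt_of_ne hij with h | h
        · exact (hne i j h k l hk0 hk1 hl0 hl1 he.symm).elim
        · exact (hne j i h l k hl0 hl1 hk0 hk1 he).elim
      · rwa [he] at h
    · exact h
  · intro i j hij u v hu hv huv
    obtain ⟨k, hk, rfl⟩ := (hPs _ _).1 hu
    obtain ⟨l, hl, rfl⟩ := (hPs _ _).1 hv
    rcases key i k hk with ⟨hk0, hk1⟩ | h
    · rcases key j l hl with ⟨hl0, hl1⟩ | h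
      · rcases lt_or_gt_of_ne hij with h | h
        · exact (hadj i j h k l hk0 hk1 hl0 hl1 huv).elim
        · exact (hadj j i h l k hl0 hl1 hk0 hk1 huv.symm).elim
      · exact .inr h
    · exact .inl h

/-- Pyramids with a path of length 1 are never needed, so all three lengths are taken to be at least
2. -/
theorem PyramidFree.false_of_paths (hG : G.PyramidFree) {a : V} (f : Fin 3 → ℕ → V)
    (n : Fin 3 → ℕ) (hf : ∀ i, G.IsInducedPath (f i) (n i)) (h0 : ∀ i, f i 0 = a)
    (hn : ∀ i, 2 ≤ n i) (htri : ∀ i j, i < j → G.Adj (f i (n i)) (f j (n j)))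
    (hne : ∀ i j, i < j → ∀ k l, 0 < k → k ≤ n i → 0 < l → l ≤ n j → f i k ≠ f j l)
    (hadj : ∀ i j, i < j → ∀ k l, 0 < k → k ≤ n i → 0 < l → l ≤ n j → G.Adj (f i k) (f j l) →
      k = n i ∧ l = n j) :
    False := by
  choose P hP hPc hPl hPs using fun i => (hf i).exists_walk (h0 i) rfl
  refine hG a (fun i => f i (n i)) P ⟨hP, hPc, fun i => ?_, ⟨0, 1, by decide, ?_, ?_⟩, ?_, ?_, ?_⟩
  · rw [hPl]
    exact one_le_two.trans (hn i)
  · rw [hPl]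
    exact hn 0
  · rw [hPl]
    exact hn 1
  · intro i j hij u hu hu'
    obtain ⟨k, hk, rfl⟩ := (hPs _ _).1 hu
    obtain ⟨l, hl, he⟩ := (hPs _ _).1 hu'
    rcases Nat.eq_zero_or_pos k with rfl | hk0
    · exact h0 i
    rcases Nat.eq_zero_or_pos l with rfl | hl0
    · rw [← he]
      exact h0 j
    rcases lt_or_gt_of_ne hij with h | h
    · exact (hne i j h k l hk0 hk hl0 hl he.symm).elim
    · exact (hne j i h l k hl0 hl hk0 hk he).elim
  · intro i j hij
    rcases lt_or_gt_of_ne hij with h | h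
    · exact htri i j h
    · exact (htri j i h).symm
  · intro i j hij u v hu hv huv
    obtain ⟨k, hk, rfl⟩ := (hPs _ _).1 hu
    obtain ⟨l, hl, rfl⟩ := (hPs _ _).1 hv
    rcases Nat.eq_zero_or_pos k with rfl | hk0
    · exact .inr (.inl (h0 i))
    rcases Nat.eq_zero_or_pos l with rfl | hl0
    · exact .inr (.inr (h0 j))
    left
    rcases lt_or_gt_of_ne hij with h | h
    · obtain ⟨rfl, rfl⟩ := hadj i j h k l hk0 hk hl0 hl huv
      exact ⟨rfl, rfl⟩
    · obtain ⟨rfl, rfl⟩ := hadj j i h l k hl0 hl hk0 hk huv.symm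
      exact ⟨rfl, rfl⟩

/-! ### Connectivity inside a set of nodes -/

/-- Some walk of `G` inside `S` joins `u` and `v`. -/
def ReachIn (G : SimpleGraph V) (S : Set V) (u v : V) : Prop :=
  ∃ p : G.Walk u v, ∀ w ∈ p.support, w ∈ S

namespace ReachIn

variable {S T : Set V} {u v w : V}

theorem refl (h : u ∈ S) : G.ReachIn S u u := ⟨.nil, by simpa using h⟩

theorem symm (h : G.ReachIn S u v) : G.ReachIn S v u := by
  obtain ⟨p, hp⟩ := h
  exact ⟨p.reverse, by simpa using hp⟩

theorem trans (h : G.ReachIn S u v) (h' : G.ReachIn S v w) : G.ReachIn S u w := by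
  obtain ⟨p, hp⟩ := h
  obtain ⟨q, hq⟩ := h'
  refine ⟨p.append q, fun x hx => ?_⟩
  rw [Walk.mem_support_append_iff] at hx
  exact hx.elim (hp x) (hq x)

theorem of_adj (h : G.Adj u v) (hu : u ∈ S) (hv : v ∈ S) : G.ReachIn S u v :=
  ⟨h.toWalk, by simp [Adj.toWalk, hu, hv]⟩

theorem mono (hST : S ⊆ T) (h : G.ReachIn S u v) : G.ReachIn T u v := by
  obtain ⟨p, hp⟩ := h
  exact ⟨p, fun w hw => hST (hp w hw)⟩

theorem left_mem (h : G.ReachIn S u v) : u ∈ S := by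
  obtain ⟨p, hp⟩ := h
  exact hp _ p.start_mem_support

theorem right_mem (h : G.ReachIn S u v) : v ∈ S := h.symm.left_mem

/-- A set that contains `u` and is closed under adjacency within `S` contains all that can be
reached from `u`. -/
theorem mem_of_closed (h : G.ReachIn S u v) (hu : u ∈ T)
    (hT : ∀ x y, x ∈ S → y ∈ S → x ∈ T → G.Adj x y → y ∈ T) : v ∈ T := by
  obtain ⟨p, hp⟩ := h
  induction p with
  | nil => exact hu
  | cons hadj p ih =>
    simp only [Walk.support_cons, List.mem_cons, forall_eq_or_imp] at hp
    exact ih (hT _ _ hp.1 (hp.2 _ p.start_mem_support) hu hadj) hp.2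

/-- A shortest walk inside `T` from `y` to `F` is an induced path. -/
theorem exists_isInducedPath (h : G.ReachIn T u v) {F : Set V} (hv : v ∈ F) :
    ∃ (f : ℕ → V) (n : ℕ), G.IsInducedPath f n ∧ f 0 = u ∧ f n ∈ F ∧ (∀ i, i ≤ n → f i ∈ T) ∧
      (∀ i, i < n → f i ∉ F) ∧ ∀ i, i + 1 < n → ∀ w ∈ F, w ∈ T → ¬ G.Adj (f i) w := by
  classical
  -- The length is minimized over all end nodes in `F` at once. A chord, a repeated node, an early
  -- visit to `F` or an early neighbor in `F` would each give a shorter walk.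
  have hex : ∃ n, ∃ w ∈ F, ∃ p : G.Walk u w, p.length = n ∧ ∀ x ∈ p.support, x ∈ T := by
    obtain ⟨p, hp⟩ := h
    exact ⟨_, v, hv, p, rfl, hp⟩
  obtain ⟨w, hw, p, hpn, hpT⟩ := Nat.find_spec hex
  have hmin : ∀ w ∈ F, ∀ q : G.Walk u w, (∀ x ∈ q.support, x ∈ T) → p.length ≤ q.length := by
    intro w hw q hq
    rw [hpn]
    exact Nat.find_min' hex ⟨w, hw, q, rfl, hq⟩
  have htake : ∀ i, ∀ x ∈ (p.take i).support, x ∈ T := fun i x hx =>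
    hpT x ((p.isSubwalk_take i).support_subset hx)
  have hdrop : ∀ i, ∀ x ∈ (p.drop i).support, x ∈ T := fun i x hx =>
    hpT x ((p.isSubwalk_drop i).support_subset hx)
  have hadj : ∀ i j, i < j → j ≤ p.length → G.Adj (p.getVert i) (p.getVert j) → i + 1 = j := by
    intro i j hij hj ha
    have := hmin w hw ((p.take i).append (.cons ha (p.drop j))) (by
      intro x hx
      rw [Walk.mem_support_append_iff, Walk.support_cons, List.mem_cons] at hx
      rcases hx with hx | rfl | hx
      · exact htake i x hx
      · exact hpT _ (p.getVert_mem_support i)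
      · exact hdrop j x hx)
    simp only [Walk.length_append, Walk.length_cons, Walk.take_length, Walk.drop_length] at this
    omega
  have hinj : ∀ i j, i < j → j ≤ p.length → p.getVert i ≠ p.getVert j := by
    intro i j hij hj he
    have := hmin w hw ((p.take i).append ((p.drop j).copy he.symm rfl)) (by
      intro x hx
      rw [Walk.mem_support_append_iff, Walk.support_copy] at hx
      exact hx.elim (htake i x) (hdrop j x))
    simp only [Walk.length_append, Walk.length_copy, Walk.take_length, Walk.drop_length] at this
    omega
  refine ⟨p.getVert, p.length, ⟨fun i j hi hj he => ?_, fun i hi => p.adj_getVert_succ hi,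
    fun i j hi hj ha => ?_⟩, p.getVert_zero, by simpa using hw,
    fun i hi => hpT _ (p.getVert_mem_support i), fun i hi hF => ?_, fun i hi x hx hxT ha => ?_⟩
  · by_contra hij
    rcases lt_or_gt_of_ne hij with h | h
    · exact hinj i j h hj he
    · exact hinj j i h hi he.symm
  · rcases lt_trichotomy i j with h | rfl | h
    · exact .inl (hadj i j h hj ha)
    · exact (ha.ne rfl).elim
    · exact .inr (hadj j i h hi ha.symm)
  · have := hmin _ hF (p.take i) (htake i)
    simp only [Walk.take_length] at this
    omega
  · have := hmin _ hx ((p.take i).concat ha) (by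
      intro y hy
      rw [Walk.support_concat, List.mem_append, List.mem_singleton] at hy
      rcases hy with hy | rfl
      · exact htake i y hy
      · exact hxT)
    simp only [Walk.length_concat, Walk.take_length] at this
    omega

/-- Initial segments of the walk reach all its nodes; hence the component of `u` in `S` is connected
in itself. -/
theorem within_component (h : G.ReachIn S u v) : G.ReachIn {w | G.ReachIn S u w} u v := by
  classical
  obtain ⟨p, hp⟩ := h
  exact ⟨p, fun w hw => ⟨p.takeUntil w hw, fun x hx =>
    hp x (p.support_takeUntil_subset_support hw hx)⟩⟩

theorem exists_isInducedPath_to (h : G.ReachIn T u v) :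
    ∃ (f : ℕ → V) (n : ℕ), G.IsInducedPath f n ∧ f 0 = u ∧ f n = v ∧ ∀ i, i ≤ n → f i ∈ T := by
  obtain ⟨f, n, hf, h0, h1, hT, -⟩ := h.exists_isInducedPath (Set.mem_singleton v)
  exact ⟨f, n, hf, h0, h1, hT⟩

end ReachIn

/-- The form in which the absence of clique cutsets is used throughout. -/
theorem reachIn_compl_of_not_isCliqueCutset (h : ∀ S : Set V, ¬ G.IsCliqueCutset S) {S : Set V}
    (hS : G.IsClique S) {u v : V} (hu : u ∉ S) (hv : v ∉ S) : G.ReachIn Sᶜ u v := by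
  have hpre : (G.induce Sᶜ).Preconnected := by
    by_contra hp
    exact h S ⟨hS, hp⟩
  have key : ∀ x y : (Sᶜ : Set V), (G.induce Sᶜ).Walk x y → G.ReachIn Sᶜ x.1 y.1 := by
    intro x y p
    induction p with
    | nil => exact .refl (Subtype.prop _)
    | @cons x y _ h p ih =>
      exact (ReachIn.of_adj (induce_adj.1 h) x.2 y.2).trans ih
  exact key ⟨u, hu⟩ ⟨v, hv⟩ (hpre _ _).some

theorem IsInducedPath.two_le {f : ℕ → V} {n : ℕ} (hf : G.IsInducedPath f n)
    (hne : f 0 ≠ f n) (hadj : ¬ G.Adj (f 0) (f n)) : 2 ≤ n := by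
  by_contra! h
  interval_cases n
  · exact hne rfl
  · exact hadj (hf.adj 0 one_pos)

/-! ### Excluding the diamond -/

/-- In a wheel-free graph, two adjacent nodes that are both adjacent to both ends of an induced
path are adjacent to its second node. It suffices to state this for one of them. -/
theorem WheelFree.adj_second (hG : G.WheelFree) {f : ℕ → V} {n : ℕ} (hf : G.IsInducedPath f n)
    (hn : 2 ≤ n) {x y : V} (hxy : G.Adj x y) (hx : ∀ i, i ≤ n → x ≠ f i)
    (hy : ∀ i, i ≤ n → y ≠ f i) (hx0 : G.Adj x (f 0)) (hxn : G.Adj x (f n)) (hy0 : G.Adj y (f 0))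
    (hyn : G.Adj y (f n)) : G.Adj x (f 1) := by
  classical
  have hex : ∃ i, 1 ≤ i ∧ G.Adj x (f i) := ⟨n, by omega, hxn⟩
  have hey : ∃ i, 1 ≤ i ∧ G.Adj y (f i) := ⟨n, by omega, hyn⟩
  -- Let `j` be the later of the two first neighbors beyond `f 0`, say that of `y`. If `j ≥ 2`, then
  -- `y` closes a hole with `f 0, …, f j`, in which `x` sees `y`, `f 0` and `f i`.
  have key : ∀ {x y : V} (i j : ℕ), G.Adj x y → (∀ i, i ≤ n → x ≠ f i) → (∀ i, i ≤ n → y ≠ f i) →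
      G.Adj x (f 0) → G.Adj y (f 0) → 1 ≤ i → G.Adj x (f i) → i ≤ j → j ≤ n → G.Adj y (f j) →
      (∀ k, k < j → ¬ (1 ≤ k ∧ G.Adj y (f k))) → j ≤ 1 := by
    intro x y i j hxy hx hy hx0 hy0 hi hxi hij hj hyj hmin
    by_contra! hj1
    refine hG.false_of_adj_path ((hf.slice 0 j (by omega))) hj1 (a := y) (c := x)
      (fun k hk => hy _ (by omega)) (fun k hk => ?_) hxy (fun k hk => hx _ (by omega)) (i := 0)
      (j := i) (by omega) (by omega) hij (by simpa using hx0) (by simpa using hxi)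
    rw [zero_add]
    constructor
    · intro hk'
      have := hmin k
      simp only [hk', and_true] at this
      omega
    · rintro (rfl | rfl)
      · exact hy0
      · exact hyj
  obtain ⟨hi1, hi2⟩ := Nat.find_spec hex
  obtain ⟨hj1, hj2⟩ := Nat.find_spec hey
  have hin := Nat.find_min' hex ⟨by omega, hxn⟩
  have hjn := Nat.find_min' hey ⟨by omega, hyn⟩
  have : Nat.find hex = 1 := by
    rcases le_total (Nat.find hex) (Nat.find hey) with h | h
    · have := key _ _ hxy hx hy hx0 hy0 hi1 hi2 h hjn hj2 fun k hk => Nat.find_min hey hk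
      omega
    · have := key _ _ hxy.symm hy hx hy0 hx0 hj1 hj2 h hin hi2 fun k hk => Nat.find_min hex hk
      omega
  rwa [this] at hi2

/-- A wheel-free graph without clique cutset contains no diamond. -/
theorem WheelFree.adj_of_common_neighbors [Finite V] (hG : G.WheelFree)
    (hcut : ∀ S : Set V, ¬ G.IsCliqueCutset S) {p q c d : V} (hpq : G.Adj p q) (hcd : c ≠ d)
    (hpc : G.Adj p c) (hpd : G.Adj p d) (hqc : G.Adj q c) (hqd : G.Adj q d) : G.Adj c d := by
  by_contra hadj
  -- The pair `c`, `d` may vary with `K`. Keeping `p` and `q` in `K` ensures that each node of `K`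
  -- has a partner for `WheelFree.adj_second`.
  let 𝒦 : Set (Set V) := {K | G.IsClique K ∧ p ∈ K ∧ q ∈ K ∧
    ∃ c d, c ≠ d ∧ ¬ G.Adj c d ∧ ∀ x ∈ K, G.Adj x c ∧ G.Adj x d}
  have hne : 𝒦.Nonempty := by
    refine ⟨{p, q}, ?_, by simp, by simp, c, d, hcd, hadj, ?_⟩
    · rw [isClique_pair]
      exact fun _ => hpq
    · rintro x (rfl | rfl)
      · exact ⟨hpc, hpd⟩
      · exact ⟨hqc, hqd⟩
  obtain ⟨K, hK⟩ := (Set.toFinite 𝒦).exists_maximal hne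
  obtain ⟨⟨hKc, hpK, hqK, c, d, hcd, hadj, hcdK⟩, hmax⟩ := hK
  have key : ∀ n, ∀ f : ℕ → V, G.IsInducedPath f n → f 0 ≠ f n → ¬ G.Adj (f 0) (f n) →
      (∀ x ∈ K, G.Adj x (f 0) ∧ G.Adj x (f n)) → (∀ i, i ≤ n → f i ∈ Kᶜ) → False := by
    intro n
    induction n with
    | zero => exact fun f _ h => (h rfl).elim
    | succ n ih =>
      intro f hf hne hna hx hfK
      have h2 := hf.two_le hne hna
      have hK1 : ∀ x ∈ K, G.Adj x (f 1) := by
        intro x hxK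
        obtain ⟨y, hyK, hxy⟩ : ∃ y ∈ K, x ≠ y := by
          by_cases h : x = p
          · exact ⟨q, hqK, by rw [h]; exact hpq.ne⟩
          · exact ⟨p, hpK, h⟩
        exact hG.adj_second hf h2 (hKc hxK hyK hxy) (fun i hi he => hfK i hi (he ▸ hxK))
          (fun i hi he => hfK i hi (he ▸ hyK)) (hx x hxK).1 (hx x hxK).2 (hx y hyK).1 (hx y hyK).2
      rcases h2.eq_or_lt with h2 | h2
      -- A path of length 2 lets `f 1` join `K`, against maximality. A longer path can lose its
      -- first node, because `K` is complete to `f 1` too.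
      · have hmem : insert (f 1) K ∈ 𝒦 := by
          refine ⟨?_, .inr hpK, .inr hqK, f 0, f (n + 1), hne, hna, ?_⟩
          · rw [isClique_insert]
            exact ⟨hKc, fun x hxK _ => (hK1 x hxK).symm⟩
          · rintro x (rfl | hxK)
            · refine ⟨(hf.adj 0 (by omega)).symm, ?_⟩
              rw [← h2]
              exact hf.adj 1 (by omega)
            · exact hx x hxK
        exact hfK 1 (by omega) (hmax hmem (Set.subset_insert _ _) (Set.mem_insert _ _))
      · refine ih (fun k => f (1 + k)) (hf.slice 1 n (by omega)) ?_ ?_ ?_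
          fun i hi => hfK _ (by omega)
        · intro he
          have := hf.inj _ _ (by omega) (by omega) he
          omega
        · intro he
          have := hf.succ_of_adj _ _ (by omega) (by omega) he
          omega
        · intro x hxK
          rw [add_comm 1 n]
          exact ⟨hK1 x hxK, (hx x hxK).2⟩
  obtain ⟨f, n, hf, h0, h1, hT⟩ := (reachIn_compl_of_not_isCliqueCutset hcut hKc
    (fun h => (hcdK c h).1.ne rfl) (fun h => (hcdK d h).2.ne rfl)).exists_isInducedPath_to
  exact key n f hf (by rwa [h0, h1]) (by rwa [h0, h1]) (by rwa [h0, h1]) hT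

/-! ### Paths attached to a hole, and connected sets attached to neighbors of a node -/

theorem IsInducedPath.exists_cons {f : ℕ → V} {n : ℕ} {a : V} (hf : G.IsInducedPath f n)
    (ha : G.Adj a (f 0)) (hne : ∀ i, 0 < i → i ≤ n → a ≠ f i)
    (hadj : ∀ i, 0 < i → i ≤ n → ¬ G.Adj a (f i)) :
    ∃ g : ℕ → V, G.IsInducedPath g (n + 1) ∧ g 0 = a ∧ ∀ i, g (i + 1) = f i :=
  ⟨_, hf.cons ha hne hadj, rfl, fun _ => rfl⟩

theorem IsInducedPath.exists_snoc {f : ℕ → V} {n : ℕ} {b : V} (hf : G.IsInducedPath f n)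
    (hb : G.Adj (f n) b) (hne : ∀ i, i < n → f i ≠ b) (hadj : ∀ i, i < n → ¬ G.Adj (f i) b) :
    ∃ g : ℕ → V, G.IsInducedPath g (n + 1) ∧ g (n + 1) = b ∧ ∀ i, i ≤ n → g i = f i :=
  ⟨_, hf.snoc hb hne hadj, by simp, fun i hi => by simp [hi]⟩

/-- In an only-prism graph, let a node `a` and an induced path `f` form a hole. Then no induced
path starting from `a` has its last node adjacent to inner nodes of `f` only, and its other nodes
except `a` without neighbors in `f`. -/
theorem IsOnlyPrism.false_of_attached_path (hG : G.IsOnlyPrism) {f g : ℕ → V} {n m : ℕ}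
    (hf : G.IsInducedPath f n) (hn : 2 ≤ n) {a : V} (ha : ∀ i, i ≤ n → a ≠ f i)
    (haf : ∀ i, i ≤ n → (G.Adj a (f i) ↔ i = 0 ∨ i = n))
    (hg : G.IsInducedPath g m) (hm : 1 ≤ m) (hg0 : g 0 = a)
    (hne : ∀ i j, 0 < i → i ≤ m → j ≤ n → g i ≠ f j)
    (hanti : ∀ i j, 0 < i → i < m → j ≤ n → ¬ G.Adj (g i) (f j))
    (hq0 : ¬ G.Adj (g m) (f 0)) (hqn : ¬ G.Adj (g m) (f n))
    (hex : ∃ j, j ≤ n ∧ G.Adj (g m) (f j)) : False := by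
  classical
  obtain ⟨hθ, hW, hP⟩ := hG
  obtain ⟨u, v, huv, hvn, hu, hv, humin, hvmax⟩ : ∃ u v, u ≤ v ∧ v ≤ n ∧ G.Adj (g m) (f u) ∧
      G.Adj (g m) (f v) ∧ (∀ j, j < u → ¬ G.Adj (g m) (f j)) ∧
      ∀ j, v < j → j ≤ n → ¬ G.Adj (g m) (f j) := by
    have hex' : ∃ j, G.Adj (g m) (f j) := by
      obtain ⟨j, -, hj⟩ := hex
      exact ⟨j, hj⟩
    obtain ⟨j, hjn, hj⟩ := hex
    refine ⟨Nat.find hex', Nat.findGreatest (fun j => G.Adj (g m) (f j)) n, ?_,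
      Nat.findGreatest_le n, Nat.find_spec hex', ?_, fun j hj => Nat.find_min hex' hj,
      fun j hj hjn => Nat.findGreatest_is_greatest hj hjn⟩
    · exact (Nat.find_min' hex' hj).trans (Nat.le_findGreatest hjn hj)
    · exact Nat.findGreatest_spec (P := fun j => G.Adj (g m) (f j)) hjn hj
  have hu0 : 0 < u := by
    rcases Nat.eq_zero_or_pos u with rfl | h
    · exact (hq0 hu).elim
    · exact h
  have hvn' : v < n := by
    rcases hvn.lt_or_eq with h | rfl
    · exact h
    · exact (hqn hv).elim
  have hga : ∀ i, 0 < i → i ≤ m → g i ≠ a := by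
    intro i hi him he
    have := hg.inj i 0 him (by omega) (he.trans hg0.symm)
    omega
  obtain ⟨A, hA, hA0, hA'⟩ := (hf.slice 0 u (by omega)).exists_cons (a := a)
    ((haf 0 (by omega)).2 (.inl rfl)) (fun i _ _ => ha _ (by omega))
    (fun i hi hi' => by
      rw [haf _ (by omega)]
      omega)
  -- `A` and `B` leave `a` along the hole in the two directions, up to the first neighbor `f u` and
  -- the last neighbor `f v` of `g m`.
  obtain ⟨B, hB, hB0, hB'⟩ := (hf.slice v (n - v) (by omega)).reverse.exists_cons (a := a)
    (by
      rw [haf _ (by omega)]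
      omega)
    (fun i _ _ => ha _ (by omega))
    (fun i hi hi' => by
      rw [haf _ (by omega)]
      omega)
  replace hA' : ∀ k, 0 < k → A k = f (k - 1) := by
    intro k hk
    obtain ⟨k, rfl⟩ : ∃ l, k = l + 1 := ⟨k - 1, by omega⟩
    simpa using hA' k
  replace hB' : ∀ k, 0 < k → k ≤ n - v + 1 → B k = f (n + 1 - k) := by
    intro k hk hk'
    obtain ⟨k, rfl⟩ : ∃ l, k = l + 1 := ⟨k - 1, by omega⟩
    rw [hB' k]
    congr 1
    omega
  -- If `u = v` there is a theta with ends `a` and `f u`. If `v = u + 1` there is a pyramid with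
  -- apex `a` and triangle `f u`, `f v`, `g m`. If `v > u + 1` there is a theta with ends `a` and `g
  -- m`.
  rcases huv.eq_or_lt with rfl | huv
  · obtain ⟨C, hC, hC1, hC'⟩ := hg.exists_snoc hu (fun i hi => by
        rcases Nat.eq_zero_or_pos i with rfl | hi0
        · rw [hg0]
          exact ha _ hvn
        · exact hne i _ hi0 hi.le hvn)
      (fun i hi => by
        rcases Nat.eq_zero_or_pos i with rfl | hi0
        · rw [hg0, haf _ hvn]
          omega
        · exact hanti i _ hi0 hi hvn)
    refine hθ.false_of_paths (a := a) (b := f u) ![A, B, C] ![u + 1, n - u + 1, m + 1] ?_ ?_ ?_ ?_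
      ?_ ?_
    · intro i
      fin_cases i
      exacts [hA, hB, hC]
    · intro i
      fin_cases i
      exacts [hA0, hB0, (hC' 0 (by omega)).trans hg0]
    · intro i
      fin_cases i
      · exact hA' (u + 1) (by omega)
      · refine (hB' (n - u + 1) (by omega) le_rfl).trans ?_
        congr 1
        omega
      · exact hC1
    · intro i
      fin_cases i
      · change 2 ≤ u + 1
        omega
      · change 2 ≤ n - u + 1
        omega
      · change 2 ≤ m + 1
        omega
    · intro i j hij k l hk0 hk hl0 hl
      fin_cases i <;> fin_cases j <;> first | exact absurd hij (by decide) | skip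
      · change k < u + 1 at hk
        change l < n - u + 1 at hl
        change A k ≠ B l
        rw [hA' k hk0, hB' l hl0 hl.le]
        intro he
        have := hf.inj _ _ (by omega) (by omega) he
        omega
      · change k < u + 1 at hk
        change l < m + 1 at hl
        change A k ≠ C l
        rw [hA' k hk0, hC' l (by omega)]
        exact (hne l _ hl0 (by omega) (by omega)).symm
      · change k < n - u + 1 at hk
        change l < m + 1 at hl
        change B k ≠ C l
        rw [hB' k hk0 hk.le, hC' l (by omega)]
        exact (hne l _ hl0 (by omega) (by omega)).symm
    · have key : ∀ l j, 0 < l → l < m + 1 → j ≤ n → j ≠ u → ¬ G.Adj (f j) (C l) := by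
        intro l j hl0 hl hj hju
        rw [hC' l (by omega), adj_comm]
        rcases (Nat.lt_succ_iff.1 hl).lt_or_eq with hl | rfl
        · exact hanti l j hl0 hl hj
        · rcases lt_or_gt_of_ne hju with h | h
          · exact humin j h
          · exact hvmax j h hj
      intro i j hij k l hk0 hk hl0 hl
      fin_cases i <;> fin_cases j <;> first | exact absurd hij (by decide) | skip
      · change k < u + 1 at hk
        change l < n - u + 1 at hl
        change ¬ G.Adj (A k) (B l)
        rw [hA' k hk0, hB' l hl0 hl.le]
        intro he
        have := hf.succ_of_adj _ _ (by omega) (by omega) he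
        omega
      · change k < u + 1 at hk
        change ¬ G.Adj (A k) (C l)
        rw [hA' k hk0]
        exact key l _ hl0 hl (by omega) (by omega)
      · change k < n - u + 1 at hk
        change ¬ G.Adj (B k) (C l)
        rw [hB' k hk0 hk.le]
        exact key l _ hl0 hl (by omega) (by omega)
  -- If `m = 1`, then `g 1` sees `a`, `f u` and `f v`, which makes a wheel.
  have hm2 : 2 ≤ m := by
    by_contra! hm2
    obtain rfl : m = 1 := by omega
    refine hW.false_of_adj_path hf hn ha haf (c := g 1) ?_ (fun i hi => hne 1 i one_pos le_rfl hi)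
      huv.ne (huv.le.trans hvn) hvn hu hv
    rw [← hg0]
    exact (hg.adj 0 one_pos).symm
  have hgm : ¬ G.Adj a (g m) := by
    rw [← hg0]
    intro h
    have := hg.succ_of_adj _ _ (by omega) (by omega) h
    omega
  by_cases huv1 : v = u + 1
  · subst huv1
    refine hP.false_of_paths (a := a) ![A, B, g] ![u + 1, n - (u + 1) + 1, m] ?_ ?_ ?_ ?_ ?_ ?_
    · intro i
      fin_cases i
      exacts [hA, hB, hg]
    · intro i
      fin_cases i
      exacts [hA0, hB0, hg0]
    · intro i
      fin_cases i
      · change 2 ≤ u + 1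
        omega
      · change 2 ≤ n - (u + 1) + 1
        omega
      · exact hm2
    · have hAu : A (u + 1) = f u := hA' _ (by omega)
      have hBu : B (n - (u + 1) + 1) = f (u + 1) := by
        rw [hB' _ (by omega) le_rfl]
        congr 1
        omega
      intro i j hij
      fin_cases i <;> fin_cases j <;> first | exact absurd hij (by decide) | skip
      · change G.Adj (A (u + 1)) (B (n - (u + 1) + 1))
        rw [hAu, hBu]
        exact hf.adj u (by omega)
      · change G.Adj (A (u + 1)) (g m)
        rw [hAu]
        exact hu.symm
      · change G.Adj (B (n - (u + 1) + 1)) (g m)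
        rw [hBu]
        exact hv.symm
    · intro i j hij k l hk0 hk hl0 hl
      fin_cases i <;> fin_cases j <;> first | exact absurd hij (by decide) | skip
      · change k ≤ u + 1 at hk
        change l ≤ n - (u + 1) + 1 at hl
        change A k ≠ B l
        rw [hA' k hk0, hB' l hl0 hl]
        intro he
        have := hf.inj _ _ (by omega) (by omega) he
        omega
      · change k ≤ u + 1 at hk
        change A k ≠ g l
        rw [hA' k hk0]
        exact (hne l _ hl0 hl (by omega)).symm
      · change k ≤ n - (u + 1) + 1 at hk
        change B k ≠ g l
        rw [hB' k hk0 hk]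
        exact (hne l _ hl0 hl (by omega)).symm
    · have key : ∀ l j, 0 < l → l ≤ m → j ≤ n → G.Adj (f j) (g l) → l = m ∧ u ≤ j ∧ j ≤ u + 1 := by
        intro l j hl0 hl hj ha
        rcases hl.lt_or_eq with hl | rfl
        · exact (hanti l j hl0 hl hj ha.symm).elim
        · refine ⟨rfl, ?_, ?_⟩
          · by_contra! h
            exact humin j h ha.symm
          · by_contra! h
            exact hvmax j h hj ha.symm
      intro i j hij k l hk0 hk hl0 hl he
      fin_cases i <;> fin_cases j <;> first | exact absurd hij (by decide) | skip
      · change k ≤ u + 1 at hk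
        change l ≤ n - (u + 1) + 1 at hl
        change G.Adj (A k) (B l) at he
        rw [hA' k hk0, hB' l hl0 hl] at he
        have := hf.succ_of_adj _ _ (by omega) (by omega) he
        change k = u + 1 ∧ l = n - (u + 1) + 1
        omega
      · change k ≤ u + 1 at hk
        change G.Adj (A k) (g l) at he
        rw [hA' k hk0] at he
        have := key l _ hl0 hl (by omega) he
        change k = u + 1 ∧ l = m
        omega
      · change k ≤ n - (u + 1) + 1 at hk
        change G.Adj (B k) (g l) at he
        rw [hB' k hk0 hk] at he
        have := key l _ hl0 hl (by omega) he
        change k = n - (u + 1) + 1 ∧ l = m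
        omega
  · obtain ⟨A₂, hA₂, hA₂1, hA₂'⟩ := hA.exists_snoc (b := g m) (by
        rw [hA' _ (by omega)]
        exact hu.symm)
      (fun i hi => by
        rcases Nat.eq_zero_or_pos i with rfl | hi0
        · rw [hA0]
          exact (hga m (by omega) le_rfl).symm
        · rw [hA' i hi0]
          exact (hne m _ (by omega) le_rfl (by omega)).symm)
      (fun i hi => by
        rcases Nat.eq_zero_or_pos i with rfl | hi0
        · rwa [hA0]
        · rw [hA' i hi0, adj_comm]
          exact humin _ (by omega))
    obtain ⟨B₂, hB₂, hB₂1, hB₂'⟩ := hB.exists_snoc (b := g m) (by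
        rw [hB' _ (by omega) le_rfl, show n + 1 - (n - v + 1) = v by omega]
        exact hv.symm)
      (fun i hi => by
        rcases Nat.eq_zero_or_pos i with rfl | hi0
        · rw [hB0]
          exact (hga m (by omega) le_rfl).symm
        · rw [hB' i hi0 hi.le]
          exact (hne m _ (by omega) le_rfl (by omega)).symm)
      (fun i hi => by
        rcases Nat.eq_zero_or_pos i with rfl | hi0
        · rwa [hB0]
        · rw [hB' i hi0 hi.le, adj_comm]
          exact hvmax _ (by omega) (by omega))
    refine hθ.false_of_paths (a := a) (b := g m) ![A₂, B₂, g] ![u + 1 + 1, n - v + 1 + 1, m]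
      ?_ ?_ ?_ ?_ ?_ ?_
    · intro i
      fin_cases i
      exacts [hA₂, hB₂, hg]
    · intro i
      fin_cases i
      exacts [(hA₂' 0 (by omega)).trans hA0, (hB₂' 0 (by omega)).trans hB0, hg0]
    · intro i
      fin_cases i
      exacts [hA₂1, hB₂1, rfl]
    · intro i
      fin_cases i
      · change 2 ≤ u + 1 + 1
        omega
      · change 2 ≤ n - v + 1 + 1
        omega
      · exact hm2
    · intro i j hij k l hk0 hk hl0 hl
      fin_cases i <;> fin_cases j <;> first | exact absurd hij (by decide) | skip
      · change k < u + 1 + 1 at hk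
        change l < n - v + 1 + 1 at hl
        change A₂ k ≠ B₂ l
        rw [hA₂' k (by omega), hA' k hk0, hB₂' l (by omega), hB' l hl0 (by omega)]
        intro he
        have := hf.inj _ _ (by omega) (by omega) he
        omega
      · change k < u + 1 + 1 at hk
        change l < m at hl
        change A₂ k ≠ g l
        rw [hA₂' k (by omega), hA' k hk0]
        exact (hne l _ hl0 hl.le (by omega)).symm
      · change k < n - v + 1 + 1 at hk
        change l < m at hl
        change B₂ k ≠ g l
        rw [hB₂' k (by omega), hB' k hk0 (by omega)]
        exact (hne l _ hl0 hl.le (by omega)).symm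
    · intro i j hij k l hk0 hk hl0 hl
      fin_cases i <;> fin_cases j <;> first | exact absurd hij (by decide) | skip
      · change k < u + 1 + 1 at hk
        change l < n - v + 1 + 1 at hl
        change ¬ G.Adj (A₂ k) (B₂ l)
        rw [hA₂' k (by omega), hA' k hk0, hB₂' l (by omega), hB' l hl0 (by omega)]
        intro he
        have := hf.succ_of_adj _ _ (by omega) (by omega) he
        omega
      · change k < u + 1 + 1 at hk
        change l < m at hl
        change ¬ G.Adj (A₂ k) (g l)
        rw [hA₂' k (by omega), hA' k hk0, adj_comm]
        exact hanti l _ hl0 hl (by omega)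
      · change k < n - v + 1 + 1 at hk
        change l < m at hl
        change ¬ G.Adj (B₂ k) (g l)
        rw [hB₂' k (by omega), hB' k hk0 (by omega), adj_comm]
        exact hanti l _ hl0 hl (by omega)

/-- A finite connected set with at least two nodes has a node, other than any given one, whose
removal leaves it connected. -/
theorem exists_reachIn_sdiff_singleton [Finite V] {S : Set V}
    (hS : ∀ u ∈ S, ∀ v ∈ S, G.ReachIn S u v) {r s : V} (hr : r ∈ S) (hs : s ∈ S) (hrs : s ≠ r) :
    ∃ v ∈ S, v ≠ r ∧ ∀ u ∈ S \ {v}, ∀ w ∈ S \ {v}, G.ReachIn (S \ {v}) u w := by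
  classical
  -- `sInf (D u)` is the distance from `r` to `u` inside `S`. A node at greatest distance is on no
  -- shortest walk from `r` to another node, so it can be removed.
  let D : V → Set ℕ := fun u => {n | ∃ p : G.Walk r u, p.length = n ∧ ∀ x ∈ p.support, x ∈ S}
  have hD : ∀ u ∈ S, ∃ p : G.Walk r u, p.length = sInf (D u) ∧ ∀ x ∈ p.support, x ∈ S := by
    intro u hu
    obtain ⟨p, hp⟩ := hS r hr u hu
    exact Nat.sInf_mem (s := D u) ⟨_, p, rfl, hp⟩
  obtain ⟨v, hv, hmax⟩ := Set.exists_max_image S (fun u => sInf (D u)) (Set.toFinite S) ⟨r, hr⟩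
  have key : ∀ u ∈ S \ {v}, G.ReachIn (S \ {v}) r u := by
    rintro u ⟨hu, huv⟩
    obtain ⟨p, hp, hpS⟩ := hD u hu
    refine ⟨p, fun x hx => ⟨hpS x hx, ?_⟩⟩
    rintro rfl
    have h1 : sInf (D x) ≤ (p.takeUntil x hx).length :=
      Nat.sInf_le ⟨_, rfl, fun y hy => hpS y (p.support_takeUntil_subset_support hx hy)⟩
    have h2 := p.length_takeUntil_lt_length hx (fun h => huv h.symm)
    have h3 := hmax u hu
    omega
  refine ⟨v, hv, ?_, fun u hu w hw => (key u hu).symm.trans (key w hw)⟩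
  rintro rfl
  obtain ⟨p, hp, -⟩ := hD s hs
  have h1 : sInf (D v) ≤ 0 := Nat.sInf_le ⟨.nil, rfl, by simpa using hv⟩
  have h2 := hmax s hs
  exact hrs (Walk.eq_of_length_eq_zero (by omega : p.length = 0)).symm

/-- A path from `x` to `z` through `S` forms a hole with `a`, and a shortest path from `y` to the
interior of that path yields an attached path as excluded by `IsOnlyPrism.false_of_attached_path`.
-/
theorem IsOnlyPrism.false_of_private_attachments (hG : G.IsOnlyPrism) {a x y z v w : V} {S : Set V}
    (hS : ∀ u ∈ S, ∀ v ∈ S, G.ReachIn S u v) (hSa : ∀ s ∈ S, s ≠ a ∧ ¬ G.Adj a s)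
    (hx : G.Adj a x) (hy : G.Adj a y) (hz : G.Adj a z) (hxy : x ≠ y) (hxz : x ≠ z) (hyz : y ≠ z)
    (hxy' : ¬ G.Adj x y) (hxz' : ¬ G.Adj x z) (hyz' : ¬ G.Adj y z)
    (hv : v ∈ S) (hw : w ∈ S) (hxv : G.Adj x v) (hzw : G.Adj z w)
    (hxS : ∀ s ∈ S, G.Adj x s → s = v) (hzS : ∀ s ∈ S, G.Adj z s → s = w)
    (hyS : ∃ s ∈ S, G.Adj y s) : False := by
  have hmono : S ⊆ insert x (insert z S) := fun s hs => .inr (.inr hs)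
  obtain ⟨f, n, hf, hf0, hfn, hfT⟩ := ((ReachIn.of_adj hxv (.inl rfl) (hmono hv)).trans
    (((hS v hv w hw).mono hmono).trans
      (ReachIn.of_adj hzw (.inr (.inl rfl)) (hmono hw)).symm)).exists_isInducedPath_to
  have hn : 2 ≤ n := hf.two_le (by rwa [hf0, hfn]) (by rwa [hf0, hfn])
  have hfS : ∀ i, 0 < i → i < n → f i ∈ S := by
    intro i hi hin
    rcases hfT i hin.le with h | h | h
    · have := hf.inj _ _ (by omega) (by omega) (h.trans hf0.symm)
      omega
    · have := hf.inj _ _ (by omega) (by omega) (Eq.trans h hfn.symm)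
      omega
    · exact h
  have hxS' : x ∉ S := fun h => (hSa x h).2 hx
  have hzS' : z ∉ S := fun h => (hSa z h).2 hz
  have hyS' : y ∉ S := fun h => (hSa y h).2 hy
  have hf1 : f 1 ∈ S := hfS 1 (by omega) (by omega)
  have hf1v : f 1 = v := hxS _ hf1 (by rw [← hf0]; exact hf.adj 0 (by omega))
  have hf1w : f (n - 1) = w := by
    refine hzS _ (hfS _ (by omega) (by omega)) ?_
    have := hf.adj (n - 1) (by omega)
    rw [show n - 1 + 1 = n by omega, hfn] at this
    exact this.symm
  obtain ⟨s, hs, hys⟩ := hyS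
  -- `F` contains `v` and `w`, the only nodes of `S` that see `x` or `z`, so the path from `y` has
  -- no neighbor of `x` or `z` before it reaches `F`.
  let F : Set V := {u | ∃ j, 0 < j ∧ j < n ∧ f j = u}
  have hmono' : S ⊆ insert y S := fun s hs => .inr hs
  obtain ⟨h, L, hh, hh0, ⟨j, hj0, hjn, hhL⟩, hhT, hhF, hhadj⟩ :=
    ((ReachIn.of_adj hys (.inl rfl) (hmono' hs)).trans
      ((hS s hs _ hf1).mono hmono')).exists_isInducedPath (F := F) ⟨1, by omega, by omega, rfl⟩
  have hL : 1 ≤ L := by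
    by_contra! h0
    obtain rfl : L = 0 := by omega
    rw [hh0] at hhL
    exact hyS' (hhL ▸ hfS j hj0 hjn)
  have hhS : ∀ i, 0 < i → i ≤ L → h i ∈ S := by
    intro i hi hiL
    rcases hhT i hiL with h | h
    · have := hh.inj _ _ (by omega) (by omega) (h.trans hh0.symm)
      omega
    · exact h
  have hhx : ∀ i, i < L → h i ≠ x ∧ h i ≠ z ∧ ¬ G.Adj (h i) x ∧ ¬ G.Adj (h i) z := by
    intro i hi
    rcases Nat.eq_zero_or_pos i with rfl | hi0
    · rw [hh0]
      exact ⟨hxy.symm, hyz, fun h => hxy' h.symm, hyz'⟩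
    · have hiS := hhS i hi0 hi.le
      refine ⟨fun he => hxS' (he ▸ hiS), fun he => hzS' (he ▸ hiS), fun he => ?_, fun he => ?_⟩
      · exact hhF i hi ⟨1, by omega, by omega, hf1v.trans (hxS _ hiS he.symm).symm⟩
      · exact hhF i hi ⟨n - 1, by omega, by omega, hf1w.trans (hzS _ hiS he.symm).symm⟩
  have hcase : ∀ j, j ≤ n → f j = x ∨ f j = z ∨ (0 < j ∧ j < n) := by
    intro j hj
    rcases Nat.eq_zero_or_pos j with rfl | hj0
    · exact .inl hf0
    · rcases hj.lt_or_eq with hj | rfl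
      · exact .inr (.inr ⟨hj0, hj⟩)
      · exact .inr (.inl hfn)
  -- The node `h L` is dropped, as it lies on the hole.
  obtain ⟨g, hg, hg0, hg'⟩ := (hh.slice 0 (L - 1) (by omega)).exists_cons (a := a)
    (by rwa [zero_add, hh0])
    (fun i hi hiL => (hSa _ (hhS _ (by omega) (by omega))).1.symm)
    (fun i hi hiL => (hSa _ (hhS _ (by omega) (by omega))).2)
  replace hg' : ∀ i, 0 < i → g i = h (i - 1) := by
    intro i hi
    obtain ⟨i, rfl⟩ : ∃ k, i = k + 1 := ⟨i - 1, by omega⟩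
    simpa using hg' i
  refine hG.false_of_attached_path hf hn (a := a) ?_ ?_ hg (by omega) hg0 ?_ ?_ ?_ ?_ ?_
  · intro i hi
    rcases hcase i hi with h | h | ⟨h1, h2⟩
    · exact h ▸ hx.ne
    · exact h ▸ hz.ne
    · exact (hSa _ (hfS i h1 h2)).1.symm
  · intro i hi
    constructor
    · intro hadj
      by_contra! hi'
      exact (hSa _ (hfS i (by omega) (by omega))).2 hadj
    · rintro (rfl | rfl)
      · rwa [hf0]
      · rwa [hfn]
  · intro i j hi hiL hj
    rw [hg' i hi]
    have := hhx (i - 1) (by omega)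
    rcases hcase j hj with h | h | ⟨h1, h2⟩
    · rw [h]
      exact this.1
    · rw [h]
      exact this.2.1
    · exact fun he => hhF (i - 1) (by omega) ⟨j, h1, h2, he.symm⟩
  · intro i j hi hiL hj
    rw [hg' i hi]
    have := hhx (i - 1) (by omega)
    rcases hcase j hj with h | h | ⟨h1, h2⟩
    · rw [h]
      exact this.2.2.1
    · rw [h]
      exact this.2.2.2
    · exact hhadj (i - 1) (by omega) _ ⟨j, h1, h2, rfl⟩ (hmono' (hfS j h1 h2))
  · rw [hg' _ (by omega), hf0]
    exact (hhx _ (by omega)).2.2.1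
  · rw [hg' _ (by omega), hfn]
    exact (hhx _ (by omega)).2.2.2
  · refine ⟨j, hjn.le, ?_⟩
    rw [hg' _ (by omega), hhL]
    have := hh.adj (L - 1) (by omega)
    rwa [show L - 1 + 1 = L by omega] at this

/-- In an only-prism graph, a connected set of non-neighbors of `a` does not have three pairwise
nonadjacent neighbors of `a` as neighbors. -/
theorem IsOnlyPrism.false_of_three_attachments [Finite V] (hG : G.IsOnlyPrism) {a : V}
    (x : Fin 3 → V) (hx : ∀ i, G.Adj a (x i)) (hxne : ∀ i j, i ≠ j → x i ≠ x j)
    (hxadj : ∀ i j, i ≠ j → ¬ G.Adj (x i) (x j)) {S : Set V}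
    (hS : ∀ u ∈ S, ∀ v ∈ S, G.ReachIn S u v) (hSa : ∀ s ∈ S, s ≠ a ∧ ¬ G.Adj a s)
    (hxS : ∀ i, ∃ s ∈ S, G.Adj (x i) s) : False := by
  let 𝒮 : Set (Set V) := {S | (∀ u ∈ S, ∀ v ∈ S, G.ReachIn S u v) ∧
    (∀ s ∈ S, s ≠ a ∧ ¬ G.Adj a s) ∧ ∀ i, ∃ s ∈ S, G.Adj (x i) s}
  obtain ⟨S, ⟨hS, hSa, hxS⟩, hmin⟩ := (Set.toFinite 𝒮).exists_minimal ⟨S, hS, hSa, hxS⟩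
  -- By minimality of `S`, removing a non-cut node `v` must deprive some `x i` of all its neighbors
  -- in `S`.
  have hpriv : ∀ v ∈ S, (∀ u ∈ S \ {v}, ∀ w ∈ S \ {v}, G.ReachIn (S \ {v}) u w) →
      ∃ i, ∀ s ∈ S, G.Adj (x i) s → s = v := by
    intro v hv hconn
    by_contra! hno
    have hmem : S \ {v} ∈ 𝒮 := ⟨hconn, fun s hs => hSa s hs.1, fun i => by
      obtain ⟨s, hs, hxs, hsv⟩ := hno i
      exact ⟨s, ⟨hs, hsv⟩, hxs⟩⟩
    exact (hmin hmem Set.sdiff_subset hv).2 rfl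
  obtain ⟨i, j, v, w, hij, hv, hw, hiv, hjw⟩ : ∃ (i j : Fin 3) (v w : V), i ≠ j ∧ v ∈ S ∧ w ∈ S ∧
      (∀ s ∈ S, G.Adj (x i) s → s = v) ∧ ∀ s ∈ S, G.Adj (x j) s → s = w := by
    obtain ⟨r, hr, -⟩ := hxS 0
    by_cases hsub : ∃ s ∈ S, s ≠ r
    · obtain ⟨s, hs, hsr⟩ := hsub
      obtain ⟨v, hv, hvr, hvc⟩ := exists_reachIn_sdiff_singleton hS hr hs hsr
      -- Taking `v` as the root gives a second non-cut node. The indices for `v` and `w` differ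
      -- because each `x i` has a neighbor in `S`.
      obtain ⟨w, hw, hwv, hwc⟩ := exists_reachIn_sdiff_singleton hS hv hr hvr.symm
      obtain ⟨i, hi⟩ := hpriv v hv hvc
      obtain ⟨j, hj⟩ := hpriv w hw hwc
      refine ⟨i, j, v, w, ?_, hv, hw, hi, hj⟩
      rintro rfl
      obtain ⟨t, ht, hit⟩ := hxS i
      exact hwv ((hj t ht hit).symm.trans (hi t ht hit))
    · push Not at hsub
      exact ⟨0, 1, r, r, by decide, hr, hr, fun s hs _ => hsub s hs, fun s hs _ => hsub s hs⟩
  obtain ⟨k, hki, hkj⟩ : ∃ k, k ≠ i ∧ k ≠ j := by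
    have key : ∀ i j : Fin 3, ∃ k, k ≠ i ∧ k ≠ j := by decide
    exact key i j
  obtain ⟨s, hs, his⟩ := hxS i
  obtain ⟨t, ht, hjt⟩ := hxS j
  have hsv := hiv s hs his
  have htw := hjw t ht hjt
  subst hsv htw
  exact hG.false_of_private_attachments hS hSa (hx i) (hx k) (hx j) (hxne _ _ hki.symm)
    (hxne _ _ hij) (hxne _ _ hkj) (hxadj _ _ hki.symm) (hxadj _ _ hij) (hxadj _ _ hkj) hs ht his
    hjt hiv hjw (hxS k)

/-! ### Excluding the claw -/

/-- `u` is joined to a neighbor of `v` by a walk all of whose nodes are non-neighbors of `a`. -/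
def AttachedAvoiding (G : SimpleGraph V) (a u v : V) : Prop :=
  ∃ w, G.ReachIn {s | s ≠ a ∧ ¬ G.Adj a s} u w ∧ G.Adj w v

/-- The component of `t` among the non-neighbors of `a` is connected, so it cannot attach to three
pairwise distinct and nonadjacent neighbors of `a`. -/
theorem IsOnlyPrism.eq_or_adj_of_attachedAvoiding [Finite V] (hG : G.IsOnlyPrism) {a t u v w : V}
    (hu : G.Adj a u) (hv : G.Adj a v) (hw : G.Adj a w) (htu : G.AttachedAvoiding a t u)
    (htv : G.AttachedAvoiding a t v) (htw : G.AttachedAvoiding a t w) :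
    (u = v ∨ G.Adj u v) ∨ (u = w ∨ G.Adj u w) ∨ v = w ∨ G.Adj v w := by
  by_contra! h
  obtain ⟨⟨h1, h1'⟩, ⟨h2, h2'⟩, h3, h3'⟩ := h
  refine hG.false_of_three_attachments ![u, v, w] (a := a)
    (S := {s | G.ReachIn {s | s ≠ a ∧ ¬ G.Adj a s} t s}) ?_ ?_ ?_ ?_ ?_ ?_
  · intro i
    fin_cases i
    exacts [hu, hv, hw]
  · intro i j hij
    fin_cases i <;> fin_cases j <;> first | exact absurd rfl hij | skip
    exacts [h1, h2, h1.symm, h3, h2.symm, h3.symm]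
  · intro i j hij
    fin_cases i <;> fin_cases j <;> first | exact absurd rfl hij | skip
    exacts [h1', h2', fun h => h1' h.symm, h3', fun h => h2' h.symm, fun h => h3' h.symm]
  · exact fun p hp q hq => (ReachIn.within_component hp).symm.trans (ReachIn.within_component hq)
  · exact fun s hs => ReachIn.right_mem (S := {s | s ≠ a ∧ ¬ G.Adj a s}) hs
  · intro i
    fin_cases i
    · obtain ⟨s, hs, hsu⟩ := htu
      exact ⟨s, hs, hsu.symm⟩
    · obtain ⟨s, hs, hsu⟩ := htv
      exact ⟨s, hs, hsu.symm⟩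
    · obtain ⟨s, hs, hsu⟩ := htw
      exact ⟨s, hs, hsu.symm⟩

/-- An only-prism graph without clique cutset contains no claw. -/
theorem IsOnlyPrism.false_of_claw [Finite V] (hG : G.IsOnlyPrism)
    (hcut : ∀ S : Set V, ¬ G.IsCliqueCutset S) {a : V} (x : Fin 3 → V) (hx : ∀ i, G.Adj a (x i))
    (hxE : ∀ i j, i ≠ j → ¬ (x i = x j ∨ G.Adj (x i) (x j))) : False := by
  let E : V → V → Prop := fun u v => u = v ∨ G.Adj u v
  have hEs : ∀ {u v}, E u v → E v u := fun h => h.imp Eq.symm Adj.symm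
  -- Without diamonds, `E` is transitive on the neighborhood of `a`: its classes are the cliques of
  -- that neighborhood.
  have hEt : ∀ {u v w}, G.Adj a u → G.Adj a v → G.Adj a w → E u v → E v w → E u w := by
    intro u v w hu hv hw huv hvw
    rcases huv with rfl | huv
    · exact hvw
    rcases hvw with rfl | hvw
    · exact .inr huv
    by_cases huw : u = w
    · exact .inl huw
    · exact .inr (hG.2.1.adj_of_common_neighbors hcut hv huw hu hw huv.symm hvw)
  let O : Set V := {s | s ≠ a ∧ ¬ G.Adj a s}
  let att : V → V → Prop := G.AttachedAvoiding a
  have hcases : ∀ v, v ≠ a → G.Adj a v ∨ v ∈ O := fun v hv => (em _).imp_right fun h => ⟨hv, h⟩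
  have hatt_adj : ∀ {t u}, t ∈ O → G.Adj t u → att t u := fun ht h => ⟨_, .refl ht, h⟩
  have hatt_step : ∀ {t t' u}, t ∈ O → t' ∈ O → G.Adj t t' → att t u → att t' u := by
    rintro t t' u ht ht' h ⟨w, hw, hwu⟩
    exact ⟨w, (ReachIn.of_adj h.symm ht' ht).trans hw, hwu⟩
  have hclique : ∀ {u}, G.Adj a u → G.IsClique {v | v = a ∨ (G.Adj a v ∧ E v u)} := by
    rintro u hu v (rfl | ⟨hv, hvu⟩) w (rfl | ⟨hw, hwu⟩) hvw
    · exact (hvw rfl).elim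
    · exact hw
    · exact hv.symm
    · exact (hEt hv hu hw hvu (hEs hwu)).resolve_left hvw
  -- some component of the non-neighbors of `a` attaches to two cliques of the neighborhood
  obtain ⟨d, x₁, x₂, hx₁, hx₂, hE12, hd₁, hd₂⟩ : ∃ d x₁ x₂, G.Adj a x₁ ∧ G.Adj a x₂ ∧ ¬ E x₁ x₂ ∧
      att d x₁ ∧ att d x₂ := by
    by_contra! hno
    have hreach : G.ReachIn {a}ᶜ (x 0) (x 1) := reachIn_compl_of_not_isCliqueCutset hcut
      (by simp) (fun h => (hx 0).ne h.symm) (fun h => (hx 1).ne h.symm)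
    -- The clique of `x 0` and the nodes of `O` attached to it: if no node of `O` attached to two
    -- cliques, `a` would separate this set from `x 1`.
    have := hreach.mem_of_closed (T := {t | (G.Adj a t ∧ E t (x 0)) ∨
      (t ∈ O ∧ ∃ u, G.Adj a u ∧ E u (x 0) ∧ att t u)}) (.inl ⟨hx 0, .inl rfl⟩) (by
        rintro t t' - ht' (⟨ht, htx⟩ | ⟨ht, u, hu, hux, htu⟩) hadj
        · rcases hcases t' ht' with h | h
          · exact .inl ⟨h, hEt h ht (hx 0) (.inr hadj.symm) htx⟩
          · exact .inr ⟨h, t, ht, htx, hatt_adj h hadj.symm⟩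
        · rcases hcases t' ht' with h | h
          · refine .inl ⟨h, hEt h hu (hx 0) ?_ hux⟩
            by_contra hE
            exact hno t t' u h hu hE (hatt_adj ht hadj) htu
          · exact .inr ⟨h, u, hu, hux, hatt_step ht h hadj htu⟩)
    rcases this with ⟨-, h⟩ | ⟨h, -⟩
    · exact hxE 0 1 (by decide) (hEs h)
    · exact h.2 (hx 1)
  -- `Z` is the union of the components of `O` that attach to no clique other than those of `x₁` and
  -- `x₂`.
  let Z : Set V := {v | v ∈ O ∧ ∀ u, G.Adj a u → att v u → E u x₁ ∨ E u x₂}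
  have hZ : ∀ {t u v}, t ∈ O → G.Adj a u → G.Adj a v → E u x₁ → E v x₂ → att t u → att t v →
      t ∈ Z := by
    intro t u v ht hu hv hux hvx htu htv
    refine ⟨ht, fun w hw htw => ?_⟩
    rcases hG.eq_or_adj_of_attachedAvoiding hu hv hw htu htv htw with h | h | h
    · exact (hE12 (hEt hx₁ hv hx₂ (hEt hx₁ hu hv (hEs hux) h) hvx)).elim
    · exact .inl (hEt hw hu hx₁ (hEs h) hux)
    · exact .inr (hEt hw hv hx₂ (hEs h) hvx)
  have hZ_step : ∀ {t t'}, t ∈ Z → t' ∈ O → G.Adj t t' → t' ∈ Z := fun ht ht' h =>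
    ⟨ht', fun u hu htu => ht.2 u hu (hatt_step ht' ht.1 h.symm htu)⟩
  have hdO : d ∈ O := by
    obtain ⟨w, hw, -⟩ := hd₁
    exact hw.left_mem
  have hdZ : d ∈ Z := hZ hdO hx₁ hx₂ (.inl rfl) (.inl rfl) hd₁ hd₂
  have hDZ : ∀ {v}, G.ReachIn O d v → v ∈ Z := fun h =>
    h.mem_of_closed hdZ fun _ _ _ hy hx hxy => hZ_step hx hy hxy
  -- a third clique of the neighborhood
  obtain ⟨z, hz, hz₁, hz₂⟩ : ∃ z, G.Adj a z ∧ ¬ E z x₁ ∧ ¬ E z x₂ := by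
    by_contra! hno
    -- A clique contains at most one `x i`, so two cliques cannot cover all three.
    have key : ∀ y, G.Adj a y → ∀ i j, i ≠ j → E (x i) y → ¬ E (x j) y := fun y hy i j hij hi hj =>
      hxE i j hij (hEt (hx i) hy (hx j) hi (hEs hj))
    by_cases h0 : E (x 0) x₁
    · exact key x₂ hx₂ 1 2 (by decide) (hno _ (hx 1) (key _ hx₁ 0 1 (by decide) h0))
        (hno _ (hx 2) (key _ hx₁ 0 2 (by decide) h0))
    · have h0' := hno _ (hx 0) h0
      by_cases h1 : E (x 1) x₁
      · exact key _ hx₂ 0 2 (by decide) h0' (hno _ (hx 2) (key _ hx₁ 1 2 (by decide) h1))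
      · exact key _ hx₂ 0 1 (by decide) h0' (hno _ (hx 1) h1)
  let Y : Set V := {v | v ≠ a ∧ v ∉ Z}
  have hNY : ∀ {u}, G.Adj a u → u ∈ Y := fun hu => ⟨hu.ne', fun h => h.1.2 hu⟩
  have hreachY : ∀ {y₁ y₂}, G.Adj a y₁ → G.Adj a y₂ → ¬ E y₁ y₂ → ¬ E z y₁ →
      (∀ v ∈ Z, ∀ u, G.Adj a u → att v u → E u y₁ ∨ E u y₂) → G.ReachIn Y z y₂ := by
    intro y₁ y₂ hy₁ hy₂ hy hzy hZy
    by_contra hno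
    have hreach := reachIn_compl_of_not_isCliqueCutset hcut (hclique hy₁) (u := z) (v := y₂)
      (by
        rintro (h | h)
        · exact hz.ne' h
        · exact hzy h.2)
      (by
        rintro (h | h)
        · exact hy₂.ne' h
        · exact hy (hEs h.2))
    -- The clique of `y₁` is removed along with `a`, so `Z` can only be entered from the clique of
    -- `y₂`, and by then `y₂` has been reached inside `Y`.
    refine hno (hreach.mem_of_closed (T := {v | G.ReachIn Y z v}) (.refl (hNY hz)) ?_)
    intro t t' ht ht' hzt hadj
    have htY : t ∈ Y := ReachIn.right_mem hzt
    have ht'a : t' ≠ a := fun h => ht' (.inl h)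
    by_cases ht'Z : t' ∈ Z
    · exfalso
      rcases hcases t htY.1 with h | h
      · rcases hZy t' ht'Z t h (hatt_adj ht'Z.1 hadj.symm) with h' | h'
        · exact ht (.inr ⟨h, h'⟩)
        · rcases h' with rfl | h'
          · exact hno hzt
          · exact hno (ReachIn.trans hzt (.of_adj h' htY (hNY hy₂)))
      · exact htY.2 (hZ_step ht'Z h hadj.symm)
    · exact ReachIn.trans hzt (.of_adj hadj htY ⟨ht'a, ht'Z⟩)
  have hr2 := hreachY hx₁ hx₂ hE12 hz₁ fun v hv u hu h => hv.2 u hu h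
  have hr1 := hreachY hx₂ hx₁ (fun h => hE12 (hEs h)) hz₂ fun v hv u hu h => (hv.2 u hu h).symm
  obtain ⟨r, m, hr, hr0, hrm, hrY⟩ := (hr1.symm.trans hr2).exists_isInducedPath_to
  -- the path `r` meets a third clique of the neighborhood
  obtain ⟨k, hkm, hka, hk₁, hk₂⟩ :
      ∃ k, k ≤ m ∧ G.Adj a (r k) ∧ ¬ E (r k) x₁ ∧ ¬ E (r k) x₂ := by
    by_contra! hno
    -- Otherwise `r` stays in the clique of `x₁` and the nodes of `O` attached to it: a passage to
    -- the clique of `x₂` would use a node of `O` attached to both, hence in `Z`, which `r` avoids.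
    have key : ∀ i, i ≤ m → (G.Adj a (r i) ∧ E (r i) x₁) ∨
        (r i ∈ O ∧ ∃ u, G.Adj a u ∧ E u x₁ ∧ att (r i) u) := by
      intro i
      induction i with
      | zero =>
        intro _
        rw [hr0]
        exact .inl ⟨hx₁, .inl rfl⟩
      | succ i ih =>
        intro hi
        have hadj := hr.adj i hi
        rcases ih (by omega) with ⟨ht, htx⟩ | ⟨ht, u, hu, hux, htu⟩
        · rcases hcases _ (hrY _ hi).1 with h | h
          · exact .inl ⟨h, hEt h ht hx₁ (.inr hadj.symm) htx⟩
          · exact .inr ⟨h, _, ht, htx, hatt_adj h hadj.symm⟩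
        · rcases hcases _ (hrY _ hi).1 with h | h
          · refine .inl ⟨h, ?_⟩
            by_contra hE
            exact (hrY i (by omega)).2
              (hZ ht hu h hux (hno _ hi h hE) htu (hatt_adj ht hadj))
          · exact .inr ⟨h, u, hu, hux, hatt_step ht h hadj htu⟩
    have := key m le_rfl
    rw [hrm] at this
    rcases this with ⟨-, h⟩ | ⟨h, -⟩
    · exact hE12 (hEs h)
    · exact h.2 hx₂
  have hm : 2 ≤ m := hr.two_le (by rw [hr0, hrm]; exact fun h => hE12 (.inl h))
    (by rw [hr0, hrm]; exact fun h => hE12 (.inr h))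
  -- the path through the component of `d`
  obtain ⟨f, n, hf, hf0, hfn, hfT⟩ : ∃ (f : ℕ → V) (n : ℕ), G.IsInducedPath f n ∧ f 0 = x₁ ∧
      f n = x₂ ∧ ∀ i, i ≤ n → f i ∈ {v | v = x₁ ∨ v = x₂ ∨ G.ReachIn O d v} := by
    obtain ⟨w₁, hw₁, hwx₁⟩ := hd₁
    obtain ⟨w₂, hw₂, hwx₂⟩ := hd₂
    have hsub : {v | G.ReachIn O d v} ⊆ {v | v = x₁ ∨ v = x₂ ∨ G.ReachIn O d v} :=
      fun v hv => .inr (.inr hv)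
    exact ((ReachIn.of_adj hwx₁.symm (.inl rfl) (hsub hw₁)).trans
      ((((ReachIn.within_component hw₁).symm.trans (ReachIn.within_component hw₂)).mono hsub).trans
      (ReachIn.of_adj hwx₂ (hsub hw₂) (.inr (.inl rfl))))).exists_isInducedPath_to
  have hn : 2 ≤ n := hf.two_le (by rw [hf0, hfn]; exact fun h => hE12 (.inl h))
    (by rw [hf0, hfn]; exact fun h => hE12 (.inr h))
  have hfD : ∀ i, 0 < i → i < n → G.ReachIn O d (f i) := by
    intro i hi hin
    rcases hfT i hin.le with h | h | h
    · have := hf.inj _ _ (by omega) (by omega) (h.trans hf0.symm)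
      omega
    · have := hf.inj _ _ (by omega) (by omega) (Eq.trans h hfn.symm)
      omega
    · exact h
  have hfa : ∀ i, i ≤ n → a ≠ f i ∧ (G.Adj a (f i) ↔ i = 0 ∨ i = n) := by
    intro i hi
    rcases Nat.eq_zero_or_pos i with rfl | hi0
    · rw [hf0]
      exact ⟨hx₁.ne, by simpa using hx₁⟩
    rcases hi.lt_or_eq with hin | rfl
    · have := (hfD i hi0 hin).right_mem
      exact ⟨this.1.symm, fun h => (this.2 h).elim, by omega⟩
    · rw [hfn]
      exact ⟨hx₂.ne, by simpa using hx₂⟩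
  have hZY : ∀ {u v}, u ∈ Z → v ∈ Y → u ≠ v := fun hu hv h => hv.2 (h ▸ hu)
  have hfr : ∀ i j, 0 < i → i < n → 0 < j → j < m → f i ≠ r j :=
    fun i j hi hin hj hjm => hZY (hDZ (hfD i hi hin)) (hrY j hjm.le)
  have hrx₁ : ∀ j, 0 < j → j ≤ m → r j ≠ x₁ := by
    intro j hj hjm he
    have := hr.inj _ _ (by omega) (by omega) (he.trans hr0.symm)
    omega
  have hrx₂ : ∀ j, j < m → r j ≠ x₂ := by
    intro j hjm he
    have := hr.inj _ _ (by omega) (by omega) (he.trans hrm.symm)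
    omega
  -- `f` and `r` form a hole in which `a` sees `x₁`, `x₂` and `r k`.
  refine hG.2.1.false_of_three_adj hf hr (hf0.trans hr0.symm) (hfn.trans hrm.symm) hn hm hfr ?_
    (c := a) (fun i hi => (hfa i hi).1) (fun i hi => (hrY i hi).1.symm)
    (S := {u | (∃ i, i ≤ n ∧ f i = u) ∨ ∃ i, i ≤ m ∧ r i = u}) (fun u hu => hu)
    (u := x₁) (v := x₂) (w := r k) (fun h => hE12 (.inl h)) (fun h => hk₁ (.inl h.symm))
    (fun h => hk₂ (.inl h.symm)) (.inl ⟨0, by omega, hf0⟩) (.inl ⟨n, le_rfl, hfn⟩)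
    (.inr ⟨k, hkm, rfl⟩) hx₁ hx₂ hka
  -- Let `f i` see `r j`. As `Z` is closed under adjacency in `O`, `r j` is a neighbor of `a` in the
  -- clique of `x₁` or `x₂`. It sees that end of `f`, `a` and `f i`, so it is the center of a wheel
  -- on the hole formed by `a` and `f`.
  intro i j hi hin hj hjm hadj
  have hfi := hDZ (hfD i hi hin)
  have hrj := hrY j hjm.le
  rcases hcases _ hrj.1 with h | h
  · have hrf : ∀ l, l ≤ n → r j ≠ f l := by
      intro l hl
      rcases hfT l hl with h | h | h
      · exact fun he => hrx₁ j hj hjm.le (he.trans h)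
      · exact fun he => hrx₂ j hjm (he.trans h)
      · exact (hZY (hDZ h) hrj).symm
    rcases hfi.2 _ h (hatt_adj hfi.1 hadj) with h' | h'
    · exact hG.2.1.false_of_adj_path hf hn (fun l hl => (hfa l hl).1) (fun l hl => (hfa l hl).2)
        h.symm hrf (i := 0) (j := i) hi.ne (by omega) hin.le
        (by rw [hf0]; exact h'.resolve_left (hrx₁ j hj hjm.le)) hadj.symm
    · exact hG.2.1.false_of_adj_path hf hn (fun l hl => (hfa l hl).1) (fun l hl => (hfa l hl).2)
        h.symm hrf (i := n) (j := i) hin.ne' le_rfl hin.le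
        (by rw [hfn]; exact h'.resolve_left (hrx₂ j hjm)) hadj.symm
  · exact hrj.2 (hZ_step hfi h hadj)

/-! ### Chordlessness of the root graph -/

/-- If the line graph of `R` is wheel-free, then `R` is chordless. -/
theorem WheelFree.isChordlessGraph_of_iso_lineGraph (hG : G.WheelFree) {W : Type*}
    {R : SimpleGraph W} (e : G ≃g R.lineGraph) : R.IsChordlessGraph := by
  classical
  intro v₀ C₀ hC₀
  rw [Walk.isChordless_iff_forall_mem_edges]
  intro u v hu hv huv
  obtain ⟨C, hC, hCe, hvC⟩ : ∃ C : R.Walk u u, C.IsCycle ∧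
      (∀ d, d ∈ C.edges ↔ d ∈ C₀.edges) ∧ v ∈ C.support :=
    ⟨C₀.rotate u hu, hC₀.rotate hu, fun d => (C₀.rotate_edges u hu).mem_iff, by simpa using hv⟩
  rw [← hCe]
  by_contra hnot
  obtain ⟨j, hj, hjL⟩ := Walk.mem_support_iff_exists_getVert.1 hvC
  have hinj : ∀ i k, i < C.length → k < C.length → C.getVert i = C.getVert k → i = k := by
    intro i k hi hk h
    exact hC.getVert_injOn' (by simp only [Set.mem_ofPred_eq]; omega)
      (by simp only [Set.mem_ofPred_eq]; omega) h
  have h0 : C.getVert 0 = u := C.getVert_zero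
  have hL : C.getVert C.length = u := C.getVert_length
  have hinj' : ∀ i k, i ≤ C.length → k ≤ C.length → C.getVert i = C.getVert k →
      i = k ∨ i = 0 ∧ k = C.length ∨ i = C.length ∧ k = 0 := by
    intro i k hi hk h
    rcases hi.lt_or_eq with hi | rfl <;> rcases hk.lt_or_eq with hk | rfl
    · exact .inl (hinj i k hi hk h)
    · have := hinj i 0 hi (by omega) (h.trans (hL.trans h0.symm))
      omega
    · have := hinj 0 k (by omega) hk ((h0.trans hL.symm).trans h)
      omega
    · exact .inl rfl
  have hj0 : j ≠ 0 := by
    rintro rfl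
    exact huv.ne (h0.symm.trans hj)
  have hjL' : j ≠ C.length := by
    rintro rfl
    exact huv.ne (hL.symm.trans hj)
  have hj1 : j ≠ 1 := by
    rintro rfl
    exact hnot ((C.mk_mem_edges_iff_exists).2 ⟨0, by omega, by rw [h0, zero_add, hj]⟩)
  have hj2 : j + 1 ≠ C.length := by
    intro h
    exact hnot ((C.mk_mem_edges_iff_exists).2 ⟨j, by omega, by rw [h, hL, hj, Sym2.eq_swap]⟩)
  -- `E k` is the node of `G` that represents the `k`-th edge of the cycle; from `C.length` on, its
  -- value is arbitrary.
  have hE : ∀ k, ∃ x : V, k < C.length → (e x).1 = s(C.getVert k, C.getVert (k + 1)) := by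
    intro k
    by_cases hk : k < C.length
    · exact ⟨e.symm ⟨s(C.getVert k, C.getVert (k + 1)), C.adj_getVert_succ hk⟩, fun _ => by simp⟩
    · exact ⟨e.symm ⟨s(u, v), huv⟩, fun h => (hk h).elim⟩
  choose E hE using hE
  obtain ⟨c, hc⟩ : ∃ c : V, (e c).1 = s(u, v) := ⟨e.symm ⟨s(u, v), huv⟩, by simp⟩
  have hadj : ∀ x y : V, G.Adj x y ↔ x ≠ y ∧ ∃ w, w ∈ (e x).1 ∧ w ∈ (e y).1 := by
    intro x y
    rw [← e.map_adj_iff, lineGraph_adj_iff_exists, e.injective.ne_iff]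
  have hshare : ∀ i k w, i < k → k < C.length → w ∈ (e (E i)).1 → w ∈ (e (E k)).1 →
      k = i + 1 ∨ i = 0 ∧ k + 1 = C.length := by
    intro i k w hik hk h1 h2
    rw [hE i (by omega), Sym2.mem_iff] at h1
    rw [hE k hk, Sym2.mem_iff] at h2
    rcases h1 with rfl | rfl <;> rcases h2 with h2 | h2 <;>
    · have := hinj' _ _ (by omega) (by omega) h2
      omega
  have hEinj : ∀ i k, i < C.length → k < C.length → E i = E k → i = k := by
    have key : ∀ i k, i < k → k < C.length → E i ≠ E k := by
      intro i k hik hk h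
      have h1 := hshare i k (C.getVert i) hik hk (by rw [hE i (by omega)]; simp)
        (by rw [← h, hE i (by omega)]; simp)
      have h2 := hshare i k (C.getVert (i + 1)) hik hk (by rw [hE i (by omega)]; simp)
        (by rw [← h, hE i (by omega)]; simp)
      have h3 := hE i (by omega)
      rw [h, hE k hk, Sym2.eq_iff] at h3
      rcases h3 with ⟨h3, -⟩ | ⟨h3, h4⟩
      · have := hinj _ _ hk (by omega) h3
        omega
      · have := hinj' _ _ (by omega) (by omega) h3
        have := hinj' _ _ (by omega) (by omega) h4
        omega
    intro i k hi hk h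
    by_contra hik
    rcases lt_or_gt_of_ne hik with h' | h'
    · exact key i k h' hk h
    · exact key k i h' hi h.symm
  have hEadj : ∀ i k, i < k → k < C.length → G.Adj (E i) (E k) →
      k = i + 1 ∨ i = 0 ∧ k + 1 = C.length := by
    intro i k hik hk h
    obtain ⟨-, w, h1, h2⟩ := (hadj _ _).1 h
    exact hshare i k w hik hk h1 h2
  have hEsucc : ∀ i, i + 1 < C.length → G.Adj (E i) (E (i + 1)) := by
    intro i hi
    rw [hadj]
    refine ⟨fun h => ?_, C.getVert (i + 1), ?_, ?_⟩
    · have := hEinj _ _ (by omega) hi h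
      omega
    · rw [hE i (by omega)]
      simp
    · rw [hE _ hi]
      simp
  have hElast : G.Adj (E 0) (E (C.length - 1)) := by
    rw [hadj]
    refine ⟨fun h => ?_, u, ?_, ?_⟩
    · have := hEinj _ _ (by omega) (by omega) h
      omega
    · rw [hE 0 (by omega), h0]
      simp
    · rw [hE _ (by omega), show C.length - 1 + 1 = C.length by omega, hL]
      simp
  have hf : G.IsInducedPath E j := by
    refine ⟨fun i k hi hk h => hEinj i k (by omega) (by omega) h, fun i hi => hEsucc i (by omega),
      fun i k hi hk h => ?_⟩
    rcases lt_trichotomy i k with h' | rfl | h'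
    · have := hEadj i k h' (by omega) h
      omega
    · exact (h.ne rfl).elim
    · have := hEadj k i h' (by omega) h.symm
      omega
  -- `r` goes round the cycle backwards from `E 0` to `E j`. The value at 0 is set apart because `E
  -- C.length` is arbitrary.
  obtain ⟨r, hr0, hr⟩ : ∃ r : ℕ → V, r 0 = E 0 ∧ ∀ k, 0 < k → r k = E (C.length - k) :=
    ⟨fun k => if k = 0 then E 0 else E (C.length - k), rfl, fun k hk => if_neg hk.ne'⟩
  have hrE : ∀ k, k ≤ C.length - j → ∃ l, r k = E l ∧ l < C.length ∧
      (k = 0 ∧ l = 0 ∨ 0 < k ∧ l + k = C.length) := by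
    intro k hk
    rcases Nat.eq_zero_or_pos k with rfl | hk0
    · exact ⟨0, hr0, by omega, by omega⟩
    · exact ⟨C.length - k, hr k hk0, by omega, by omega⟩
  have hrpath : G.IsInducedPath r (C.length - j) := by
    refine ⟨fun i k hi hk h => ?_, fun i hi => ?_, fun i k hi hk h => ?_⟩
    · obtain ⟨l, hl, hlL, hl'⟩ := hrE i hi
      obtain ⟨l₂, hl₂, hlL₂, hl₂'⟩ := hrE k hk
      rw [hl, hl₂] at h
      have := hEinj _ _ hlL hlL₂ h
      omega
    · rcases Nat.eq_zero_or_pos i with rfl | hi0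
      · rw [hr0, hr _ (by omega)]
        exact hElast
      · rw [hr i hi0, hr _ (by omega)]
        have := (hEsucc (C.length - (i + 1)) (by omega)).symm
        rwa [show C.length - (i + 1) + 1 = C.length - i by omega] at this
    · obtain ⟨l, hl, hlL, hl'⟩ := hrE i hi
      obtain ⟨l₂, hl₂, hlL₂, hl₂'⟩ := hrE k hk
      rw [hl, hl₂] at h
      rcases lt_trichotomy l l₂ with h' | rfl | h'
      · have := hEadj _ _ h' hlL₂ h
        omega
      · exact (h.ne rfl).elim
      · have := hEadj _ _ h' hlL h.symm
        omega
  have hcE : ∀ i, i < C.length → c ≠ E i := by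
    intro i hi h
    refine hnot ((C.mk_mem_edges_iff_exists).2 ⟨i, hi, ?_⟩)
    rw [← hE i hi, ← h, hc]
  have hcE' : ∀ i, i < C.length → ∀ w, w ∈ s(u, v) → w ∈ s(C.getVert i, C.getVert (i + 1)) →
      G.Adj c (E i) := by
    intro i hi w h1 h2
    rw [hadj]
    exact ⟨hcE i hi, w, hc ▸ h1, (hE i hi).symm ▸ h2⟩
  -- The chord `c` shares `u` with `E 0`, and `v` with both `E (j - 1)` and `E j`. That `uv` is not
  -- an edge of the cycle makes both paths have length at least 2.
  refine hG.false_of_three_adj hf hrpath hr0.symm ?_ (by omega) (by omega) ?_ ?_ (c := c)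
    (fun i hi => hcE i (by omega)) ?_ (S := {x | ∃ i, i ≤ j ∧ E i = x}) (fun x hx => .inl hx)
    (u := E 0) (v := E (j - 1)) (w := E j) ?_ ?_ ?_ ⟨0, by omega, rfl⟩ ⟨j - 1, by omega, rfl⟩
    ⟨j, le_rfl, rfl⟩ ?_ ?_ ?_
  · rw [hr _ (by omega)]
    congr 1
    omega
  · intro i k hi hij hk hkj h
    rw [hr k hk] at h
    have := hEinj _ _ (by omega) (by omega) h
    omega
  · intro i k hi hij hk hkj h
    rw [hr k hk] at h
    have := hEadj _ _ (by omega) (by omega) h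
    omega
  · intro i hi
    obtain ⟨l, hl, hlL, -⟩ := hrE i hi
    rw [hl]
    exact hcE l hlL
  · intro h
    have := hEinj _ _ (by omega) (by omega) h
    omega
  · intro h
    have := hEinj _ _ (by omega) (by omega) h
    omega
  · intro h
    have := hEinj _ _ (by omega) (by omega) h
    omega
  · exact hcE' 0 (by omega) u (by simp) (by rw [h0]; simp)
  · refine hcE' (j - 1) (by omega) v (by simp) ?_
    rw [show j - 1 + 1 = j by omega, hj]
    simp
  · exact hcE' j (by omega) v (by simp) (by rw [hj]; simp)

/-! ### Construction of the root graph -/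

/-- A graph without claw and diamond is the line graph of a triangle-free graph. -/
theorem exists_cliqueFree_three_iso_lineGraph [Finite V]
    (hdiamond : ∀ p q c d, G.Adj p q → c ≠ d → G.Adj p c → G.Adj p d → G.Adj q c → G.Adj q d →
      G.Adj c d)
    (hclaw : ∀ (a : V) (x : Fin 3 → V), (∀ i, G.Adj a (x i)) →
      (∀ i j, i ≠ j → ¬ (x i = x j ∨ G.Adj (x i) (x j))) → False) :
    ∃ (W : Type) (_ : Finite W) (R : SimpleGraph W),
      R.CliqueFree 3 ∧ Nonempty (G ≃g R.lineGraph) := by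
  classical
  have htrans : ∀ {a u v w}, G.Adj a u → G.Adj a v → G.Adj a w → (u = v ∨ G.Adj u v) →
      (v = w ∨ G.Adj v w) → (u = w ∨ G.Adj u w) := by
    intro a u v w hu hv hw huv hvw
    rcases huv with rfl | huv
    · exact hvw
    rcases hvw with rfl | hvw
    · exact .inr huv
    exact or_iff_not_imp_left.2 fun huw => hdiamond a v u w hv huw hu hw huv.symm hvw
  have hside : ∀ v, ∃ s : V → Bool, ∀ w w', G.Adj v w → G.Adj v w' →
      (s w = s w' ↔ w = w' ∨ G.Adj w w') := by
    intro v
    by_cases hv : ∃ r, G.Adj v r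
    · obtain ⟨r, hr⟩ := hv
      -- One side is the clique of a chosen neighbor `r`. Two neighbors outside it are equal or
      -- adjacent, since otherwise they would form a claw with `r`.
      refine ⟨fun w => decide (w = r ∨ G.Adj w r), fun w w' hw hw' => ?_⟩
      rw [decide_eq_decide]
      constructor
      · intro h
        by_cases h1 : w = r ∨ G.Adj w r
        · exact htrans hw hr hw' h1 ((h.1 h1).imp Eq.symm Adj.symm)
        · have h2 := fun h' => h1 (h.2 h')
          by_contra h3
          refine hclaw v ![r, w, w'] ?_ ?_
          · intro i
            fin_cases i
            exacts [hr, hw, hw']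
          · intro i j hij
            fin_cases i <;> fin_cases j <;> first | exact absurd rfl hij | skip
            exacts [fun h => h1 (h.imp Eq.symm Adj.symm), fun h => h2 (h.imp Eq.symm Adj.symm), h1,
              h3, h2, fun h => h3 (h.imp Eq.symm Adj.symm)]
      · exact fun h => ⟨fun h' => htrans hw' hw hr (h.imp Eq.symm Adj.symm) h',
          fun h' => htrans hw hw' hr h h'⟩
    · exact ⟨fun _ => true, fun w w' hw => (hv ⟨w, hw⟩).elim⟩
  choose s hs using hside
  -- the nodes of the root graph are the classes of half-edges `(v, i)` under this relation
  let rel : Setoid (V × Bool) :=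
    { r := fun p q => p = q ∨ (G.Adj p.1 q.1 ∧ p.2 = s p.1 q.1 ∧ q.2 = s q.1 p.1)
      iseqv := by
        refine ⟨fun p => .inl rfl, ?_, ?_⟩
        · rintro p q (rfl | ⟨h1, h2, h3⟩)
          · exact .inl rfl
          · exact .inr ⟨h1.symm, h3, h2⟩
        · rintro ⟨p, i⟩ ⟨q, j⟩ ⟨r, k⟩ (h | ⟨h1, h2, h3⟩) (h' | ⟨h4, h5, h6⟩)
          · exact .inl (h.trans h')
          · rw [h]
            exact .inr ⟨h4, h5, h6⟩
          · rw [← h']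
            exact .inr ⟨h1, h2, h3⟩
          · dsimp only at *
            rcases (hs q p r h1.symm h4).1 (h3.symm.trans h5) with rfl | hpr
            · exact .inl (by rw [h2, h6])
            · refine .inr ⟨hpr, ?_, ?_⟩
              · rw [h2]
                exact (hs p q r h1 hpr).2 (.inr h4)
              · rw [h6]
                exact (hs r q p h4.symm hpr.symm).2 (.inr h1.symm) }
  obtain ⟨n, ⟨φ⟩⟩ := Finite.exists_equiv_fin (Quotient rel)
  obtain ⟨f, hf⟩ : ∃ f : V × Bool → Fin n, ∀ p q, f p = f q ↔
      (p = q ∨ (G.Adj p.1 q.1 ∧ p.2 = s p.1 q.1 ∧ q.2 = s q.1 p.1)) :=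
    ⟨fun p => φ ⟦p⟧, fun p q => by rw [φ.injective.eq_iff]; exact Quotient.eq⟩
  let edge : V → Sym2 (Fin n) := fun v => s(f (v, false), f (v, true))
  have hmem : ∀ v x, x ∈ edge v ↔ ∃ i, x = f (v, i) := by
    intro v x
    rw [Sym2.mem_iff, Bool.exists_bool]
  have hdiag : ∀ v, ¬ (edge v).IsDiag := by
    intro v h
    rw [Sym2.mk_isDiag_iff, hf] at h
    rcases h with h | h
    · exact Bool.false_ne_true (Prod.ext_iff.1 h).2
    · exact h.1.ne rfl
  have hadj : ∀ v w, v ≠ w → ((∃ x, x ∈ edge v ∧ x ∈ edge w) ↔ G.Adj v w) := by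
    intro v w hvw
    constructor
    · rintro ⟨x, hx, hx'⟩
      obtain ⟨i, rfl⟩ := (hmem v _).1 hx
      obtain ⟨j, hj⟩ := (hmem w _).1 hx'
      rcases (hf _ _).1 hj with h | h
      · exact (hvw (Prod.ext_iff.1 h).1).elim
      · exact h.1
    · intro h
      exact ⟨f (v, s v w), (hmem _ _).2 ⟨_, rfl⟩,
        (hmem _ _).2 ⟨s w v, (hf _ _).2 (.inr ⟨h, rfl, rfl⟩)⟩⟩
  have hinj : Function.Injective edge := by
    intro v w h
    by_contra hvw
    -- Distinct nodes share at most the end on the side `s v w`, so they cannot have both ends in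
    -- common.
    have key : ∀ i, i = s v w := by
      intro i
      have hx : f (v, i) ∈ edge w := h ▸ (hmem v _).2 ⟨i, rfl⟩
      obtain ⟨j, hj⟩ := (hmem w _).1 hx
      rcases (hf _ _).1 hj with h | h
      · exact (hvw (Prod.ext_iff.1 h).1).elim
      · exact h.2.1
    exact Bool.false_ne_true ((key false).trans (key true).symm)
  let R : SimpleGraph (Fin n) := fromEdgeSet (Set.range edge)
  have hRe : R.edgeSet = Set.range edge := by
    rw [edgeSet_fromEdgeSet]
    ext x
    simp only [Set.mem_sdiff, and_iff_left_iff_imp]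
    rintro ⟨v, rfl⟩
    exact hdiag v
  refine ⟨Fin n, inferInstance, R, ?_, ⟨?_⟩⟩
  · intro t ht
    obtain ⟨a, b, c, hab, hac, hbc, -⟩ := is3Clique_iff.1 ht
    rw [← mem_edgeSet, hRe] at hab hac hbc
    obtain ⟨u, hu⟩ := hab
    obtain ⟨v, hv⟩ := hac
    obtain ⟨w, hw⟩ := hbc
    have hd := hdiag u
    have hd' := hdiag v
    have hd'' := hdiag w
    rw [hu, Sym2.mk_isDiag_iff] at hd
    rw [hv, Sym2.mk_isDiag_iff] at hd'
    rw [hw, Sym2.mk_isDiag_iff] at hd''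
    have key : ∀ {x y z p q}, edge p = s(x, y) → edge q = s(x, z) → y ≠ z →
        ∃ i, x = f (p, i) ∧ G.Adj p q ∧ i = s p q := by
      intro x y z p q hp hq hyz
      have hpq : p ≠ q := by
        rintro rfl
        rw [hp, Sym2.congr_right] at hq
        exact hyz hq
      obtain ⟨i, hi⟩ := (hmem p x).1 (by rw [hp]; simp)
      obtain ⟨j, hj⟩ := (hmem q x).1 (by rw [hq]; simp)
      rcases (hf _ _).1 (hi.symm.trans hj) with h | h
      · exact (hpq (Prod.ext_iff.1 h).1).elim
      · exact ⟨i, hi, h.1, h.2.1⟩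
    obtain ⟨i, hi, huv, rfl⟩ := key hu hv hd''
    obtain ⟨j, hj, huw, rfl⟩ := key (hu.trans Sym2.eq_swap) hw hd'
    obtain ⟨-, -, hvw, -⟩ := key (hv.trans Sym2.eq_swap) (hw.trans Sym2.eq_swap) hd
    -- The three edges of a triangle are pairwise adjacent in `G`, so `v` and `w` are on the same
    -- side of `u`; the two ends of the edge `u` would then coincide.
    exact hd (hi.trans ((congrArg f (by rw [(hs u v w huv huw).2 (.inr hvw)])).trans hj.symm))
  · refine ⟨Equiv.ofBijective (fun v => ⟨edge v, hRe.symm ▸ ⟨v, rfl⟩⟩) ⟨?_, ?_⟩, ?_⟩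
    · exact fun v w h => hinj (congrArg Subtype.val h)
    · rintro ⟨x, hx⟩
      obtain ⟨v, rfl⟩ := hRe ▸ hx
      exact ⟨v, rfl⟩
    · intro v w
      change R.lineGraph.Adj ⟨edge v, _⟩ ⟨edge w, _⟩ ↔ G.Adj v w
      rw [lineGraph_adj_iff_exists]
      by_cases hvw : v = w
      · simp [hvw]
      · rw [← hadj v w hvw, ne_eq, Subtype.mk.injEq, hinj.eq_iff]
        simp [hvw]

end SimpleGraph

theorem theorem2p5 {V : Type*} [Finite V] (G : SimpleGraph V) (hG : G.IsOnlyPrism) :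
    (∃ (W : Type) (_ : Finite W) (R : SimpleGraph W),
      R.CliqueFree 3 ∧ R.IsChordlessGraph ∧ Nonempty (G ≃g R.lineGraph)) ∨
    ∃ S : Set V, G.IsCliqueCutset S := by
  rw [or_iff_not_imp_right]
  intro hcut
  push Not at hcut
  obtain ⟨W, hW, R, hR, ⟨e⟩⟩ := SimpleGraph.exists_cliqueFree_three_iso_lineGraph (G := G)
    (fun p q c d hpq hcd => hG.2.1.adj_of_common_neighbors hcut hpq hcd)
    (fun a x hx hxE => hG.false_of_claw hcut x hx hxE)
  exact ⟨W, hW, R, hR, hG.2.1.isChordlessGraph_of_iso_lineGraph e, ⟨e⟩⟩
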